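/- Let $\Omega\subset\mathbb R^2$ be a nonempty bounded open set with a conforming triangulation $\mathcal T$ (finitely many nondegenerate triangles that meet only in common faces and whose union is $\overline\Omega$) for which $\partial\Omega$ is a union of mesh edges. Let $q_i$ be its vertices and $\varphi_i$ the continuous piecewise linear basis functions, $\varphi_i(q_j)=\delta_{ij}$; call $q_i$ free if $q_i\notin\partial\Omega$, and let $\mathcal V$ be the span of the $\varphi_i$ with $q_i$ free. Two vertices are neighbors if they are joined by a mesh edge $e_{ij}$; $\omega_{ij}$ is the union of the triangles having $q_i$ and $q_j$ as vertices ($\omega_{ii}=\operatorname{supp}\varphi_i$). Below, "for each $\omega_{ij}$" means: for each free $q_i$ and each neighbor $q_j$ of $q_i$, free or on $\partial\Omega$. *Coefficients.* $\kappa(x,\eta),g(x,\eta)$ are measurable in $x$ for each $\eta\in\mathbb R$ and $C^1$ in $\eta$ for a.e. $x\in\Omega$, $g$ is nondecreasing in $\eta$, and there are constants $0<k_\alpha<k_\beta$, $K_\eta>0$, $G_\eta$ such that, for all $\eta$ and a.e. $x$, $k_\alpha\le\kappa\le k_\beta$, $|\partial_\eta\kappa|\le K_\eta$, $0\le\partial_\eta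 g\le G_\eta$. *Mesh.* All angles of the triangles are at most $\pi/2$, and there are constants $\beta_m,\beta_M>0$ such that for each $\omega_{ij}$ $$\cot\theta_{ij}^++\cot\theta_{ij}^->\beta_m,\qquad \cot\theta_{ij}^++\cot\theta_{ij}^-+\sum_{T\subset\omega_{ij}}\cot\theta_{i,T}\le\beta_M,$$ where $\theta_{ij}^\pm$ are the angles opposite $e_{ij}$ in the triangles of $\omega_{ij}$ and $\theta_{i,T}$ is the angle of $T$ at $q_i$. *Matrix.* Let $u_1,u_2\in\mathcal V$, $z(t)=tu_1+(1-t)u_2$, $b(x)=\int_0^1\partial_\eta\kappa(x,z(t))\,dt$, $c(x)=\int_0^1\partial_\eta g(x,z(t))\,dt$. Let $A=(a_{ij})$, indexed by the free vertices, be $$a_{ij}=\int_{\omega_{ij}}\kappa(x,u_1)\nabla\varphi_j\cdot\nabla\varphi_i\,dx+\int_{\omega_{ij}}b\,\varphi_j\nabla u_2\cdot\nabla\varphi_i\,dx+\int_{\omega_{ij}}c\,\varphi_j\varphi_i\,dx ,$$ and let $\mathcal J_{ij}$ be the sum of the first two of these three terms for $a_{ji}$. Let $\delta_{\omega_{ij}}(u_2)$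 be the largest value of $|u_2(q_k)-u_2(q_l)|$ over the edges $e_{kl}$ in $\omega_{ij}$, and let $|T_{\mathcal T}|$ be the largest area of a triangle. Consider the conditions (Z) $\dfrac1{3\beta_m}\left\{K_\eta\beta_M\delta_{\omega_{ij}}(u_2)+G_\eta|T_{\mathcal T}|\right\}\le k_\alpha$ for each $\omega_{ij}$; (P) $|u_2(q_i)-u_2(q_j)|<3k_\alpha/K_\eta$ for each free $q_i$ and each neighbor $q_j$ of $q_i$; (S$_{\bar\varepsilon}$) $\dfrac{K_\eta\beta_M\delta_{\omega_{ij}}(u_2)}{3\beta_m}<k_\alpha-\bar\varepsilon$ for each $\omega_{ij}$. *Distance.* For a free vertex $q_i$ let $p_i$ be the least number of edges of a path in the mesh from $q_i$ to a free vertex that has a neighbor on $\partial\Omega$ (so $p_i=0$ if $q_i$ itself has such a neighbor). **Claim 1.** Suppose that (Z), (P) and, for some $\bar\varepsilon>0$, (S$_{\bar\varepsilon}$) hold. Let $m$ be the largest number of neighbors of a vertex. There are numbers $\mathcal J_L,\mathcal J^U$ with $$\tfrac12\beta_m\bar\varepsilon\le\mathcal J_L\le\mathcal J^U,\qquad \mathcal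 J_L\le|\mathcal J_{ij}|\le\mathcal J^U\ \text{ for all neighboring free } q_i,q_j .$$ For any such numbers and any $0<\varepsilon_0<1$ put $$r=\frac{\mathcal J_L}{m\,\mathcal J^U},\qquad \delta_0=\frac{\bar\varepsilon\beta_m(1-\varepsilon_0)}{2m\,\mathcal J^U},\qquad \varepsilon_p=\varepsilon_{p-1}-r^{p-1}\delta_0\quad(p\ge1),$$ and let $D_\varepsilon$ be the diagonal matrix with entries $d_i=1-\varepsilon_{p_i}$. Then $0<r<1$, $0<\delta_0<1$, every $d_i$ is positive, and $A^TD_\varepsilon$ is strictly diagonally dominant: in each row, the modulus of the diagonal entry exceeds the sum of the moduli of the other entries. **Claim 2** (relaxation as $\bar\varepsilon\to0$). (S$_{\bar\varepsilon}$) holds for all sufficiently small $\bar\varepsilon>0$ if and only if (Z) with strict inequality and without the term $G_\eta|T_{\mathcal T}|$ holds. In particular, (S$_{\bar\varepsilon}$) holds for all sufficiently small $\bar\varepsilon>0$ if (Z) holds with strict inequality, and also if $G_\eta>0$ and (Z) holds as it stands. -/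

import Mathlib

open Set Filter Topology MeasureTheory

noncomputable section

/-- The Euclidean plane. -/
abbrev Plane : Type := EuclideanSpace ℝ (Fin 2)

/-- A conforming triangulation of (the closure of) a planar set `Ω` whose boundary is resolved by
the mesh. The vertices are indexed by `V`; an element is given by the set of its three vertices. -/
structure Triangulation (V : Type*) [Fintype V] [DecidableEq V] (Ω : Set Plane) where
  /-- the position `q_i` of the vertex with index `i` -/
  node : V → Plane
  /-- the triangles of the mesh -/
  elems : Finset (Finset V)
  node_injective : Function.Injective node
  card_elem : ∀ T ∈ elems, T.card = 3
  nondegenerate : ∀ T ∈ elems, AffineIndependent ℝ (fun v : T => node v)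
  exists_elem : ∀ v : V, ∃ T ∈ elems, v ∈ T
  /-- two elements meet exactly in the face spanned by their common vertices -/
  conforming : ∀ S ∈ elems, ∀ T ∈ elems,
    convexHull ℝ (node '' (S : Set V)) ∩ convexHull ℝ (node '' (T : Set V)) =
      convexHull ℝ (node '' ((S ∩ T : Finset V) : Set V))
  closure_eq : closure Ω = ⋃ T ∈ elems, convexHull ℝ (node '' (T : Set V))
  /-- the boundary of `Ω` is a union of edges of the mesh -/
  frontier_eq : ∃ B : Set (V × V),
    (∀ e ∈ B, e.1 ≠ e.2 ∧ ∃ T ∈ elems, e.1 ∈ T ∧ e.2 ∈ T) ∧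
      frontier Ω = ⋃ e ∈ B, segment ℝ (node e.1) (node e.2)

namespace Triangulation

variable {V : Type*} [Fintype V] [DecidableEq V] {Ω : Set Plane} (M : Triangulation V Ω)

/-- The closed triangle spanned by the vertices in `T`. -/
def cell (T : Finset V) : Set Plane := convexHull ℝ (M.node '' (T : Set V))

/-- The area `|T|` of an element. -/
def area (T : Finset V) : ℝ := volume.real (M.cell T)

/-- The largest area of an element. -/
def maxArea : ℝ := sSup {a : ℝ | ∃ T ∈ M.elems, a = M.area T}

/-- The elements that have both `q_i` and `q_j` as vertices. -/
def patch (i j : V) : Finset (Finset V) := M.elems.filter (fun T => i ∈ T ∧ j ∈ T)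

/-- `ω_ij`, the union of the elements having both `q_i` and `q_j` as vertices
(for `i = j` this is `ω_i`). -/
def omega (i j : V) : Set Plane := ⋃ T ∈ M.patch i j, M.cell T

/-- The graph of the mesh: vertices are adjacent when they are the endpoints of an edge. -/
def graph : SimpleGraph V where
  Adj i j := i ≠ j ∧ ∃ T ∈ M.elems, i ∈ T ∧ j ∈ T
  symm := ⟨fun _ _ h => ⟨h.1.symm, h.2.imp fun _ hT => ⟨hT.1, hT.2.2, hT.2.1⟩⟩⟩
  loopless := ⟨fun _ h => h.1 rfl⟩

/-- The indices of the degrees of freedom: the vertices off the Dirichlet boundary `∂Ω`. -/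
abbrev Free : Type _ := {i : V // M.node i ∉ frontier Ω}

instance : Fintype M.Free := Fintype.ofFinite _

/-- `w` is the family of barycentric coordinates of `x` in some element that contains `x`. -/
def IsBary (w : V → ℝ) (x : Plane) : Prop :=
  ∃ T ∈ M.elems, (∀ v, 0 ≤ w v) ∧ (∀ v, v ∉ T → w v = 0) ∧
    ∑ v, w v = 1 ∧ ∑ v, w v • M.node v = x

open Classical in
/-- The piecewise linear basis function `φ_i`: on every element that contains `x`, the `i`-th
barycentric coordinate of `x` (conformity makes this independent of the element); zero off the
mesh. -/
def hat (i : V) (x : Plane) : ℝ :=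
  if h : ∃ w : V → ℝ, M.IsBary w x then h.choose i else 0

/-- The discrete space, spanned by the basis functions of the non-Dirichlet vertices. -/
def discreteSpace : Submodule ℝ (Plane → ℝ) :=
  Submodule.span ℝ (Set.range fun i : M.Free => M.hat i)

/-- The difference of nodal values over the edge `e_ij`. -/
def edgeDiff (v : Plane → ℝ) (i j : V) : ℝ := |v (M.node i) - v (M.node j)|

/-- The largest difference of nodal values over the edges in `ω_ij`. -/
def patchDiff (v : Plane → ℝ) (i j : V) : ℝ :=
  sSup {d : ℝ | ∃ T ∈ M.patch i j, ∃ k ∈ T, ∃ l ∈ T, d = M.edgeDiff v k l}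

/-- The sum of the cotangents of the angles opposite the edge `e_ij`, over the elements sharing
this edge. In each of them the inner sum has one term, for the third vertex. -/
def cotOpposite (i j : V) : ℝ :=
  ∑ T ∈ M.patch i j, ∑ k ∈ T \ {i, j},
    Real.cot (EuclideanGeometry.angle (M.node i) (M.node k) (M.node j))

/-- The sum of the cotangents of the angles at the vertex `q_i`, over the elements sharing
the edge `e_ij`. -/
def cotAt (i j : V) : ℝ :=
  ∑ T ∈ M.patch i j, ∑ k ∈ T \ {i, j},
    Real.cot (EuclideanGeometry.angle (M.node j) (M.node i) (M.node k))

/-- The angle conditions on the mesh. The patches `ω_ij` are those of the edges with a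
non-Dirichlet endpoint `q_i`; the other endpoint `q_j` may lie on the boundary. -/
structure AngleCondition (βm βM : ℝ) : Prop where
  βm_pos : 0 < βm
  βM_pos : 0 < βM
  nonobtuse : ∀ T ∈ M.elems, ∀ i ∈ T, ∀ j ∈ T, ∀ k ∈ T, i ≠ j → j ≠ k → i ≠ k →
    EuclideanGeometry.angle (M.node i) (M.node j) (M.node k) ≤ Real.pi / 2
  opposite : ∀ (i : M.Free) (j : V), M.graph.Adj i j → βm < M.cotOpposite i j
  full : ∀ (i : M.Free) (j : V), M.graph.Adj i j → M.cotOpposite i j + M.cotAt i j ≤ βM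

end Triangulation

/-- The assumptions on the coefficients `κ` and `g`. -/
structure CoefficientAssumption (Ω : Set Plane) (κ g : Plane → ℝ → ℝ) (kα kβ Kη Gη : ℝ) :
    Prop where
  kα_pos : 0 < kα
  kα_lt_kβ : kα < kβ
  Kη_pos : 0 < Kη
  κ_measurable : ∀ η : ℝ, AEMeasurable (fun x => κ x η) (volume.restrict Ω)
  g_measurable : ∀ η : ℝ, AEMeasurable (fun x => g x η) (volume.restrict Ω)
  κ_contDiff : ∀ᵐ x ∂(volume.restrict Ω), ContDiff ℝ 1 (κ x)
  g_contDiff : ∀ᵐ x ∂(volume.restrict Ω), ContDiff ℝ 1 (g x)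
  κ_bounds : ∀ᵐ x ∂(volume.restrict Ω), ∀ η : ℝ, kα ≤ κ x η ∧ κ x η ≤ kβ
  κ_deriv : ∀ᵐ x ∂(volume.restrict Ω), ∀ η : ℝ, |deriv (κ x) η| ≤ Kη
  g_monotone : ∀ᵐ x ∂(volume.restrict Ω), Monotone (g x)
  g_deriv : ∀ᵐ x ∂(volume.restrict Ω), ∀ η : ℝ, 0 ≤ deriv (g x) η ∧ deriv (g x) η ≤ Gη

/-- For `f = κ` this is the coefficient `b`, for `f = g` the coefficient `c`: the mean of
`∂f/∂η (x, z(t))` over `0 ≤ t ≤ 1`, where `z(t) = t u₁ + (1 - t) u₂`. -/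
def meanDeriv (f : Plane → ℝ → ℝ) (u₁ u₂ : Plane → ℝ) (x : Plane) : ℝ :=
  ∫ t in (0 : ℝ)..1, deriv (f x) (t * u₁ x + (1 - t) * u₂ x)

namespace Triangulation

variable {V : Type*} [Fintype V] [DecidableEq V] {Ω : Set Plane} (M : Triangulation V Ω)

/-- The diffusion and convection part of the entry with test function `φ_i` and trial
function `φ_j`. -/
def diffConv (κ : Plane → ℝ → ℝ) (u₁ u₂ : Plane → ℝ) (i j : V) : ℝ :=
  (∫ x in M.omega i j, κ x (u₁ x) * inner ℝ (gradient (M.hat j) x) (gradient (M.hat i) x)) +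
    ∫ x in M.omega i j,
      meanDeriv κ u₁ u₂ x * inner ℝ (gradient u₂ x) (gradient (M.hat i) x) * M.hat j x

/-- The assembled coefficient matrix `A` of the linearized problem. -/
def assembled (κ g : Plane → ℝ → ℝ) (u₁ u₂ : Plane → ℝ) : Matrix M.Free M.Free ℝ :=
  Matrix.of fun i j => M.diffConv κ u₁ u₂ i j +
    ∫ x in M.omega i j, meanDeriv g u₁ u₂ x * M.hat j x * M.hat i x

/-- The condition under which `A` is a `Z`-matrix. -/
def ZCondition (kα Kη Gη βm βM : ℝ) (u₂ : Plane → ℝ) : Prop :=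
  ∀ (i : M.Free) (j : V), M.graph.Adj i j →
    1 / (3 * βm) * (Kη * βM * M.patchDiff u₂ i j + Gη * M.maxArea) ≤ kα

/-- The `Z`-matrix condition with strict inequality. -/
def StrictZCondition (kα Kη Gη βm βM : ℝ) (u₂ : Plane → ℝ) : Prop :=
  ∀ (i : M.Free) (j : V), M.graph.Adj i j →
    1 / (3 * βm) * (Kη * βM * M.patchDiff u₂ i j + Gη * M.maxArea) < kα

/-- The condition under which the diagonal of `A` is positive. -/
def DiagCondition (kα Kη : ℝ) (u₂ : Plane → ℝ) : Prop :=
  ∀ (i : M.Free) (j : V), M.graph.Adj i j → M.edgeDiff u₂ i j < 3 * kα / Kη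

/-- The condition for strict diagonal dominance, with margin `ε`. -/
def DominanceCondition (kα Kη βm βM : ℝ) (u₂ : Plane → ℝ) (ε : ℝ) : Prop :=
  ∀ (i : M.Free) (j : V), M.graph.Adj i j →
    Kη * βM * M.patchDiff u₂ i j / (3 * βm) < kα - ε

/-- The vertex `q_i` has a neighbor on the Dirichlet boundary. -/
def NearBoundary (i : V) : Prop := ∃ k, M.graph.Adj i k ∧ M.node k ∈ frontier Ω

/-- `p_i`: the least number of edges of a path in the mesh from `q_i` to a non-Dirichlet vertex
that has a neighbor on the Dirichlet boundary. -/
def boundaryDist (i : V) : ℕ :=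
  sInf {n : ℕ | ∃ j : M.Free, M.NearBoundary j ∧ ∃ w : M.graph.Walk i j, w.length = n}

/-- The largest number of neighbors of a vertex. -/
def maxNeighbors : ℕ := Finset.univ.sup fun i : V => (M.graph.neighborSet i).ncard

/-- `J_L` and `J^U` are lower and upper bounds for the modulus of the diffusion and convection
part `J_ij` of `a_ji`, over the edges joining two non-Dirichlet vertices, with
`J_L ≥ β_m ε̄ / 2`. -/
def CouplingBounds (κ : Plane → ℝ → ℝ) (u₁ u₂ : Plane → ℝ) (βm ε JL JU : ℝ) : Prop :=
  βm * ε / 2 ≤ JL ∧ JL ≤ JU ∧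
    ∀ i j : M.Free, M.graph.Adj i j →
      JL ≤ |M.diffConv κ u₁ u₂ j i| ∧ |M.diffConv κ u₁ u₂ j i| ≤ JU

end Triangulation

/-- The sequence `ε_p` with `ε_p = ε_{p-1} - r^(p-1) δ₀` for `p ≥ 1`. -/
def epsSeq (ε₀ r δ₀ : ℝ) : ℕ → ℝ
  | 0 => ε₀
  | p + 1 => epsSeq ε₀ r δ₀ p - r ^ p * δ₀

/-- Strict (row) diagonal dominance. -/
def StrictlyDiagDominant {n : Type*} [Fintype n] [DecidableEq n] (A : Matrix n n ℝ) : Prop :=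
  ∀ i, ∑ j ∈ Finset.univ.erase i, |A i j| < |A i i|

end

/-! Write `J(j,i)` for the diffusion-convection part of the entry with test function `φ_j` and trial
function `φ_i`. The test function enters `J(j,i)` only through its gradient, and the hat functions
sum to one, so the sum of `J(j,i)` over all vertices `j`, boundary ones included, is zero
(`sum_diffConv`). Let `D` be the weight `d`, extended by zero to boundary vertices. Then the
weighted column sum `∑ J(j,i) d_j` over the free vertices equals `∑ (-J(j,i)) (D_i - D_j)` over the
neighbors `j` of `i`.

The cotangent formula on each triangle makes every `-J(j,i)` larger than `βm ε / 2`
(`diffConv_lt_neg`). The weights grow with the distance `p` from the boundary by the geometrically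
decreasing steps `r^p δ₀`. A neighbor of `q_i` therefore causes a loss of at most `J^U r^p δ₀`. One
neighbor gives a gain: a boundary vertex if `p = 0`, a free vertex at distance `p - 1` otherwise.
The choice of `δ₀` and `r` makes this gain at least `m` times the largest loss, and at most `m - 1`
other neighbors remain. So the weighted sum is positive (`sum_diffConv_mul_pos`).

The reaction term is nonnegative, hence only increases this sum, and condition (Z) keeps the
off-diagonal entries nonpositive even with it (`diffConv_add_massEntry_nonpos`). For such a matrix a
positive weighted column sum is strict diagonal dominance of `AᵀD`. That every vertex has a finite
distance to the boundary is a topological fact (`exists_reachable_boundary`). The second claim rests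
on the finiteness of the set of edges. -/

noncomputable section

/-! ### Barycentric coordinates on a triangle: gradients, the cotangent formula, exact integrals. -/

/-- The two-dimensional cross product. -/
def cross (a b : Plane) : ℝ := a 0 * b 1 - a 1 * b 0

/-- The barycentric coordinate with respect to `a` in the triangle with vertices `a`, `b`, `c`. -/
def bcoord (a b c x : Plane) : ℝ := cross (b - x) (c - x) / cross (b - a) (c - a)

/-- The gradient of the barycentric coordinate with respect to `a`. -/
def bgrad (a b c : Plane) : Plane :=
  (cross (b - a) (c - a))⁻¹ • !₂[b 1 - c 1, c 0 - b 0]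

theorem cross_rotate (a b c : Plane) : cross (c - b) (a - b) = cross (b - a) (c - a) := by
  simp only [cross, PiLp.sub_apply]; ring

theorem cross_swap (a b c : Plane) : cross (c - a) (b - a) = -cross (b - a) (c - a) := by
  simp only [cross, PiLp.sub_apply]; ring

/-- Reversing the orientation changes the sign of both factors. Hence `slope`, which orders the
other two vertices by choice, does not depend on that choice. -/
theorem bgrad_swap (a b c : Plane) : bgrad a c b = bgrad a b c := by
  rw [bgrad, bgrad, cross_swap a b c, inv_neg, neg_smul, ← smul_neg]
  congr 1
  ext i; fin_cases i <;> simp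

theorem bcoord_combo {a b c : Plane} (h : cross (b - a) (c - a) ≠ 0) {α β γ : ℝ}
    (hs : α + β + γ = 1) : bcoord a b c (α • a + β • b + γ • c) = α := by
  obtain rfl : α = 1 - β - γ := by linarith
  rw [bcoord, div_eq_iff h]
  simp only [cross, PiLp.sub_apply, PiLp.add_apply, PiLp.smul_apply, smul_eq_mul]
  ring

theorem bcoord_sum {a b c : Plane} (h : cross (b - a) (c - a) ≠ 0) (x : Plane) :
    bcoord a b c x + bcoord b c a x + bcoord c a b x = 1 := by
  rw [bcoord, bcoord, bcoord, cross_rotate a b c, cross_rotate b c a, cross_rotate a b c,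
    ← add_div, ← add_div, div_eq_iff h]
  simp only [cross, PiLp.sub_apply]
  ring

theorem bcoord_reproduce {a b c : Plane} (h : cross (b - a) (c - a) ≠ 0) (x : Plane) :
    bcoord a b c x • a + bcoord b c a x • b + bcoord c a b x • c = x := by
  have h1 := bcoord_sum h x
  rw [bcoord, bcoord, bcoord, cross_rotate a b c, cross_rotate b c a, cross_rotate a b c] at *
  ext i
  simp only [PiLp.add_apply, PiLp.smul_apply, smul_eq_mul]
  rw [div_mul_eq_mul_div, div_mul_eq_mul_div, div_mul_eq_mul_div, ← add_div, ← add_div,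
    div_eq_iff h]
  simp only [cross, PiLp.sub_apply]
  fin_cases i <;> simp <;> ring

theorem mem_convexHull_triple {a b c x : Plane} :
    x ∈ convexHull ℝ {a, b, c} ↔
      ∃ α β γ : ℝ, 0 ≤ α ∧ 0 ≤ β ∧ 0 ≤ γ ∧ α + β + γ = 1 ∧ α • a + β • b + γ • c = x := by
  constructor
  · rw [convexHull_insert (by simp), convexHull_pair]
    intro hx
    simp only [convexJoin, mem_iUnion, mem_singleton_iff] at hx
    obtain ⟨_, rfl, y, ⟨s, t, hs, ht, hst, rfl⟩, u, v, hu, hv, huv, rfl⟩ := hx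
    refine ⟨u, v * s, v * t, hu, by positivity, by positivity, ?_, ?_⟩
    · linear_combination huv + v * hst
    · module
  · rintro ⟨α, β, γ, hα, hβ, hγ, hs, rfl⟩
    have hc := convex_convexHull ℝ ({a, b, c} : Set Plane)
    have := hc.sum_mem (t := Finset.univ) (w := ![α, β, γ]) (z := ![a, b, c])
      (by intro i _; fin_cases i <;> simpa) (by simp [Fin.sum_univ_three, hs])
      (by intro i _; fin_cases i <;> exact subset_convexHull _ _ (by simp))
    simpa [Fin.sum_univ_three] using this

theorem hasGradientAt_bcoord (a b c x : Plane) : HasGradientAt (bcoord a b c) (bgrad a b c) x := by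
  have h : bcoord a b c = fun y => inner ℝ (bgrad a b c) y +
      (cross (b - a) (c - a))⁻¹ * cross b c := by
    ext y
    rw [bcoord, bgrad, real_inner_smul_left, div_eq_inv_mul, ← mul_add]
    congr 1
    simp [cross, PiLp.inner_apply, Fin.sum_univ_two]
    ring
  rw [h]
  exact (InnerProductSpace.toDual ℝ Plane (bgrad a b c)).hasFDerivAt.add_const _

theorem continuous_bcoord (a b c : Plane) : Continuous (bcoord a b c) :=
  continuous_iff_continuousAt.2 fun x => (hasGradientAt_bcoord a b c x).continuousAt

theorem bgrad_sum (a b c : Plane) : bgrad a b c + bgrad b c a + bgrad c a b = 0 := by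
  rw [bgrad, bgrad, bgrad, cross_rotate a b c, cross_rotate b c a, cross_rotate a b c,
    ← smul_add, ← smul_add]
  convert! smul_zero _
  ext i; fin_cases i <;> simp

theorem cross_ne_zero_of_independent {a b c : Plane}
    (h : ∀ α β γ : ℝ, α + β + γ = 0 → α • a + β • b + γ • c = 0 → β = 0 ∧ γ = 0) :
    cross (b - a) (c - a) ≠ 0 := by
  intro h0
  have key : ∀ i : Fin 2, b i - a i = 0 := by
    intro i
    -- If `b - a` and `c - a` are parallel, their `i`-th coordinates, crossed over, are the
    -- coefficients of an affine relation. Independence then forces `b = a`, which is itself a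
    -- relation.
    have h1 := h ((b i - a i) - (c i - a i)) (c i - a i) (-(b i - a i)) (by ring) (by
      ext l
      simp only [cross, PiLp.sub_apply] at h0
      fin_cases i <;> fin_cases l <;> simp <;> linarith)
    linarith [h1.2]
  have := (h 1 (-1) 0 (by ring) (by
    ext l
    simp
    linarith [key l])).1
  norm_num at this

/-- Each gradient is the opposite edge turned by a right angle and divided by twice the signed area,
so the inner product is `-(a - c)·(b - c) / cross²`. Lagrange's identity gives the sine at `c` as
`|cross|` over the product of the lengths, and the quotient with the cosine is the cotangent. -/
theorem inner_bgrad {a b c : Plane} (h : cross (b - a) (c - a) ≠ 0) :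
    |cross (b - a) (c - a)| / 2 * inner ℝ (bgrad a b c) (bgrad b c a) =
      - Real.cot (EuclideanGeometry.angle a c b) / 2 := by
  have hp : a - c ≠ 0 := by
    rintro h1
    apply h
    rw [← cross_rotate, ← cross_rotate]
    simp [cross, h1]
  have hq : b - c ≠ 0 := by
    rintro h1
    apply h
    rw [← cross_rotate, ← cross_rotate]
    simp [cross, h1]
  have hcr : cross (b - a) (c - a) = cross (a - c) (b - c) := by
    rw [← cross_rotate, ← cross_rotate]
  have hn : 0 < ‖a - c‖ * ‖b - c‖ := mul_pos (norm_pos_iff.2 hp) (norm_pos_iff.2 hq)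
  have hlag : (‖a - c‖ * ‖b - c‖) ^ 2 - inner ℝ (a - c) (b - c) ^ 2 =
      cross (b - a) (c - a) ^ 2 := by
    rw [hcr, mul_pow, EuclideanSpace.norm_sq_eq, EuclideanSpace.norm_sq_eq]
    simp [cross, PiLp.inner_apply, Fin.sum_univ_two]
    ring
  have hcos : Real.cos (EuclideanGeometry.angle a c b) =
      inner ℝ (a - c) (b - c) / (‖a - c‖ * ‖b - c‖) := by
    rw [EuclideanGeometry.angle, InnerProductGeometry.cos_angle]; rfl
  have hsin : Real.sin (EuclideanGeometry.angle a c b) =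
      |cross (b - a) (c - a)| / (‖a - c‖ * ‖b - c‖) := by
    rw [eq_div_iff hn.ne', EuclideanGeometry.angle]
    have := InnerProductGeometry.sin_angle_mul_norm_mul_norm (a -ᵥ c) (b -ᵥ c)
    refine this.trans ?_
    rw [← Real.sqrt_sq_eq_abs]
    congr 1
    rw [← hlag, mul_pow, ← real_inner_self_eq_norm_sq, ← real_inner_self_eq_norm_sq]
    simp only [vsub_eq_sub]
    ring
  rw [Real.cot_eq_cos_div_sin, hcos, hsin]
  have hi : inner ℝ (bgrad a b c) (bgrad b c a) =
      - inner ℝ (a - c) (b - c) / |cross (b - a) (c - a)| ^ 2 := by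
    rw [sq_abs, bgrad, bgrad, cross_rotate a b c, real_inner_smul_left, real_inner_smul_right,
      ← mul_assoc, ← sq, inv_pow, div_eq_inv_mul]
    congr 1
    simp [PiLp.inner_apply, Fin.sum_univ_two]
    ring
  rw [hi]
  have h' : |cross (b - a) (c - a)| ≠ 0 := abs_ne_zero.2 h
  have := hn.ne'
  field_simp

/-- The reference triangle. -/
def refTriangle : Set Plane := {y | 0 ≤ y 0 ∧ 0 ≤ y 1 ∧ y 0 + y 1 ≤ 1}

theorem convexHull_triple_eq_image (a b c : Plane) :
    convexHull ℝ {a, b, c} =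
      (fun y : Plane => y 0 • (a - c) + y 1 • (b - c) + c) '' refTriangle := by
  ext x
  rw [mem_convexHull_triple]
  constructor
  · rintro ⟨α, β, γ, hα, hβ, hγ, hs, rfl⟩
    refine ⟨!₂[α, β], ⟨by simpa, by simpa, by simp; linarith⟩, ?_⟩
    obtain rfl : γ = 1 - α - β := by linarith
    simp
    module
  · rintro ⟨y, ⟨h0, h1, h2⟩, rfl⟩
    exact ⟨y 0, y 1, 1 - y 0 - y 1, h0, h1, by linarith, by ring, by module⟩

theorem isClosed_refTriangle : IsClosed refTriangle := by
  simp only [refTriangle, ofPred_and]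
  exact (isClosed_le (by fun_prop) (by fun_prop)).inter <|
    (isClosed_le (by fun_prop) (by fun_prop)).inter (isClosed_le (by fun_prop) (by fun_prop))

theorem integral_refTriangle {φ : ℝ → ℝ → ℝ} (hφ : Continuous (Function.uncurry φ)) :
    ∫ y in refTriangle, φ (y 0) (y 1) = ∫ s in (0 : ℝ)..1, ∫ t in (0 : ℝ)..(1 - s), φ s t := by
  set e : Plane ≃ᵐ ℝ × ℝ :=
    (MeasurableEquiv.toLp 2 (Fin 2 → ℝ)).symm.trans MeasurableEquiv.finTwoArrow with he
  have hmp : MeasurePreserving e volume volume :=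
    (volume_preserving_finTwoArrow ℝ).comp
      (EuclideanSpace.volume_preserving_symm_measurableEquiv_toLp (Fin 2))
  set S : Set (ℝ × ℝ) := {p | 0 ≤ p.1 ∧ 0 ≤ p.2 ∧ p.1 + p.2 ≤ 1} with hS
  have hSc : IsClosed S := by
    simp only [hS, ofPred_and]
    exact (isClosed_le (by fun_prop) (by fun_prop)).inter <|
      (isClosed_le (by fun_prop) (by fun_prop)).inter (isClosed_le (by fun_prop) (by fun_prop))
  have hSk : IsCompact S := by
    apply (isCompact_Icc (a := (0 : ℝ × ℝ)) (b := 1)).of_isClosed_subset hSc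
    rintro ⟨p, q⟩ ⟨h0, h1, h2⟩
    simp only at h0 h1 h2
    refine ⟨⟨h0, h1⟩, ⟨?_, ?_⟩⟩ <;> simp <;> linarith
  have hpre : refTriangle = e ⁻¹' S := rfl
  have hfe : (fun y : Plane => φ (y 0) (y 1)) = fun y => Function.uncurry φ (e y) := rfl
  rw [hpre, hfe, hmp.setIntegral_preimage_emb e.measurableEmbedding (Function.uncurry φ) S,
    ← integral_indicator hSc.measurableSet, Measure.volume_eq_prod, integral_prod]
  · rw [intervalIntegral.integral_of_le zero_le_one, ← integral_Icc_eq_integral_Ioc,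
      ← integral_indicator measurableSet_Icc]
    congr 1
    ext s
    by_cases hs : s ∈ Icc (0 : ℝ) 1
    · rw [indicator_of_mem hs, intervalIntegral.integral_of_le (by linarith [hs.2]),
        ← integral_Icc_eq_integral_Ioc, ← integral_indicator measurableSet_Icc]
      congr 1
      ext t
      have : (s, t) ∈ S ↔ t ∈ Icc 0 (1 - s) :=
        ⟨fun h => ⟨h.2.1, by linarith [h.2.2]⟩, fun h => ⟨hs.1, h.1, by linarith [h.2]⟩⟩
      by_cases ht : t ∈ Icc 0 (1 - s)
      · rw [indicator_of_mem ht, indicator_of_mem (this.2 ht)]; rfl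
      · rw [indicator_of_notMem ht, indicator_of_notMem (mt this.1 ht)]
    · rw [indicator_of_notMem hs]
      have : ∀ t, S.indicator (Function.uncurry φ) (s, t) = 0 := fun t =>
        indicator_of_notMem (fun h => hs ⟨h.1, by linarith [h.2.1, h.2.2]⟩) _
      simp [this]
  · rw [integrable_indicator_iff hSc.measurableSet]
    exact hφ.continuousOn.integrableOn_compact hSk

/-- Change of variables from the reference triangle. The barycentric coordinates invert the affine
parametrization, which gives both its injectivity and the transformed integrand. -/
theorem integral_triangle {a b c : Plane} (h : cross (b - a) (c - a) ≠ 0)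
    {φ : ℝ → ℝ → ℝ} (hφ : Continuous (Function.uncurry φ)) :
    ∫ x in convexHull ℝ {a, b, c}, φ (bcoord a b c x) (bcoord b c a x) =
      |cross (b - a) (c - a)| * ∫ s in (0 : ℝ)..1, ∫ t in (0 : ℝ)..(1 - s), φ s t := by
  set L : Plane →ₗ[ℝ] Plane := Matrix.toEuclideanLin
    !![(a - c) 0, (b - c) 0; (a - c) 1, (b - c) 1] with hL
  have hLy : ∀ y, L y = y 0 • (a - c) + y 1 • (b - c) := by
    intro y
    ext l
    fin_cases l <;>
      simp [hL, Matrix.toLpLin_apply, dotProduct, Fin.sum_univ_two] <;> ring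
  have hdet : (LinearMap.toContinuousLinearMap L).det = cross (b - a) (c - a) := by
    rw [ContinuousLinearMap.det, LinearMap.coe_toContinuousLinearMap, hL,
      Matrix.toEuclideanLin_eq_toLin_orthonormal, LinearMap.det_toLin, Matrix.det_fin_two_of]
    simp only [cross, PiLp.sub_apply]; ring
  have hF : ∀ y, HasFDerivAt (fun y : Plane => y 0 • (a - c) + y 1 • (b - c) + c)
      (LinearMap.toContinuousLinearMap L) y := by
    intro y
    have : (fun y : Plane => y 0 • (a - c) + y 1 • (b - c) + c) =
      fun y => LinearMap.toContinuousLinearMap L y + c := by ext1 y; simp [hLy]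
    rw [this]
    exact (LinearMap.toContinuousLinearMap L).hasFDerivAt.add_const c
  have h1 : ∀ y : Plane, bcoord a b c (y 0 • (a - c) + y 1 • (b - c) + c) = y 0 := by
    intro y
    refine (congrArg (bcoord a b c) ?_).trans
      (bcoord_combo (α := y 0) (β := y 1) (γ := 1 - y 0 - y 1) h (by ring))
    module
  have h2 : ∀ y : Plane, bcoord b c a (y 0 • (a - c) + y 1 • (b - c) + c) = y 1 := by
    intro y
    refine (congrArg (bcoord b c a) ?_).trans
      (bcoord_combo (α := y 1) (β := 1 - y 0 - y 1) (γ := y 0)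
        (by rwa [cross_rotate a b c]) (by ring))
    module
  rw [convexHull_triple_eq_image,
    integral_image_eq_integral_abs_det_fderiv_smul volume isClosed_refTriangle.measurableSet
      (fun y _ => (hF y).hasFDerivWithinAt)
      (fun y _ z _ hyz => by
        simp only at hyz
        ext l
        fin_cases l
        · simpa [h1] using congrArg (bcoord a b c) hyz
        · simpa [h2] using congrArg (bcoord b c a) hyz)]
  simp only [h1, h2, hdet, smul_eq_mul]
  rw [integral_const_mul, integral_refTriangle hφ]

theorem volume_triangle {a b c : Plane} (h : cross (b - a) (c - a) ≠ 0) :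
    volume.real (convexHull ℝ {a, b, c}) = |cross (b - a) (c - a)| / 2 := by
  have := integral_triangle h (φ := fun _ _ => 1) (by fun_prop)
  simp only [integral_const, intervalIntegral.integral_const, MeasurableSet.univ,
    measureReal_restrict_apply, univ_inter, smul_eq_mul, mul_one] at this
  have h2 : ∫ s in (0 : ℝ)..1, (1 - s - 0) = 1 / 2 := by
    simp only [sub_zero]
    rw [intervalIntegral.integral_sub (by simp) (by simp)]
    simp
    norm_num
  rw [this, h2]
  ring

theorem integral_bcoord {a b c : Plane} (h : cross (b - a) (c - a) ≠ 0) :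
    ∫ x in convexHull ℝ {a, b, c}, bcoord a b c x =
      volume.real (convexHull ℝ {a, b, c}) / 3 := by
  have := integral_triangle h (φ := fun s _ => s) (by fun_prop)
  rw [this, volume_triangle h]
  have : ∀ s : ℝ, ∫ t in (0 : ℝ)..(1 - s), s = s - s ^ 2 := by
    intro s; simp; ring
  simp only [this]
  rw [intervalIntegral.integral_sub (by simp) (by simp)]
  simp
  norm_num
  ring

theorem integral_bcoord_mul_bcoord {a b c : Plane} (h : cross (b - a) (c - a) ≠ 0) :
    ∫ x in convexHull ℝ {a, b, c}, bcoord a b c x * bcoord b c a x =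
      volume.real (convexHull ℝ {a, b, c}) / 12 := by
  have := integral_triangle h (φ := fun s t => s * t) (by fun_prop)
  rw [this, volume_triangle h]
  have : ∀ s : ℝ, ∫ t in (0 : ℝ)..(1 - s), s * t = (s / 2 - s ^ 2) + s ^ 3 / 2 := by
    intro s; rw [intervalIntegral.integral_const_mul]; simp; ring
  simp only [this]
  rw [intervalIntegral.integral_add (by apply Continuous.intervalIntegrable; fun_prop)
      (by apply Continuous.intervalIntegrable; fun_prop),
    intervalIntegral.integral_sub (by apply Continuous.intervalIntegrable; fun_prop)
      (by apply Continuous.intervalIntegrable; fun_prop)]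
  simp
  norm_num
  ring

/-- A planar convex hull of at most two points is a null set. -/
theorem volume_convexHull_image_eq_zero {ι : Type*} [DecidableEq ι] (p : ι → Plane) {s : Finset ι}
    (hs : s.card ≤ 2) : volume (convexHull ℝ (p '' (s : Set ι))) = 0 := by
  rcases s.eq_empty_or_nonempty with rfl | hne
  · simp
  refine measure_mono_null (convexHull_subset_affineSpan _)
    (Measure.addHaar_affineSubspace volume _ fun h => ?_)
  have h1 := finrank_vectorSpan_image_finset_le ℝ p s (n := s.card - 1)
    (by have := hne.card_pos; omega)
  rw [Finset.coe_image, ← direction_affineSpan, h, AffineSubspace.direction_top, finrank_top,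
    finrank_euclideanSpace, Fintype.card_fin] at h1
  omega

theorem triple_rotate {V : Type*} [DecidableEq V] (i j k : V) : ({j, k, i} : Finset V) = {i, j, k} := by
  ext; simp; tauto

/-! ### Hat functions, their elementwise gradients, and the geometry of patches. -/

namespace Triangulation

variable {V : Type*} [Fintype V] [DecidableEq V] {Ω : Set Plane} (M : Triangulation V Ω)

theorem mem_convexHull_node_iff {T : Finset V} {x : Plane} :
    x ∈ convexHull ℝ (M.node '' (T : Set V)) ↔ ∃ w : V → ℝ, (∀ v, 0 ≤ w v) ∧
      (∀ v, v ∉ T → w v = 0) ∧ ∑ v, w v = 1 ∧ ∑ v, w v • M.node v = x := by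
  constructor
  · intro hx
    rw [← Finset.coe_image, Finset.mem_convexHull'] at hx
    obtain ⟨w, h0, h1, h2⟩ := hx
    rw [Finset.sum_image M.node_injective.injOn] at h1 h2
    refine ⟨fun v => if v ∈ T then w (M.node v) else 0, fun v => ?_, fun v hv => if_neg hv, ?_, ?_⟩
    · dsimp only
      split_ifs with hv
      · exact h0 _ (Finset.mem_image_of_mem _ hv)
      · exact le_rfl
    · rw [← h1, Finset.sum_ite_mem, Finset.univ_inter]
    · rw [← h2]
      simp only [ite_smul, zero_smul]
      rw [Finset.sum_ite_mem, Finset.univ_inter]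
  · rintro ⟨w, h0, h1, h2, h3⟩
    have hs : ∑ v ∈ T, w v = 1 := by
      rw [← h2]; exact Finset.sum_subset (Finset.subset_univ _) fun v _ hv => h1 v hv
    have hx : ∑ v ∈ T, w v • M.node v = x := by
      rw [← h3]
      exact Finset.sum_subset (Finset.subset_univ _) fun v _ hv => by rw [h1 v hv, zero_smul]
    rw [← hx]
    exact (convex_convexHull ℝ _).sum_mem (fun v _ => h0 v) hs fun v hv =>
      subset_convexHull _ _ (mem_image_of_mem _ hv)

/-- Neither the sign nor the total of the weights is prescribed, so the comparison with zero weights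
is allowed; `cross_ne_zero` uses it. -/
theorem weights_unique {T : Finset V} (hT : T ∈ M.elems) {w w' : V → ℝ}
    (h0 : ∀ v, v ∉ T → w v = 0) (h0' : ∀ v, v ∉ T → w' v = 0) (h1 : ∑ v, w v = ∑ v, w' v)
    (h2 : ∑ v, w v • M.node v = ∑ v, w' v • M.node v) : w = w' := by
  have h := M.nondegenerate T hT
  rw [affineIndependent_iff] at h
  have e1 : ∑ v : T, (w v - w' v) = 0 := by
    rw [Finset.sum_coe_sort T (fun v => w v - w' v), Finset.sum_subset (Finset.subset_univ T)
      (fun v _ hv => by rw [h0 v hv, h0' v hv, sub_zero]), Finset.sum_sub_distrib, h1, sub_self]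
  have e2 : ∑ v : T, (w v - w' v) • M.node v = 0 := by
    rw [Finset.sum_coe_sort T (fun v => (w v - w' v) • M.node v),
      Finset.sum_subset (Finset.subset_univ T)
      (fun v _ hv => by rw [h0 v hv, h0' v hv, sub_zero, zero_smul])]
    simp only [sub_smul]
    rw [Finset.sum_sub_distrib, h2, sub_self]
  ext v
  by_cases hv : v ∈ T
  · exact sub_eq_zero.1 (h Finset.univ (fun v => w v - w' v) e1 e2 ⟨v, hv⟩ (Finset.mem_univ _))
  · rw [h0 v hv, h0' v hv]

/-- By conformity `x` lies in the common face. Weights supported there are admissible in both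
elements, so affine independence identifies each family with them. This makes `hat` independent of
the choice in its definition. -/
theorem isBary_unique {w w' : V → ℝ} {x : Plane} (h : M.IsBary w x) (h' : M.IsBary w' x) :
    w = w' := by
  obtain ⟨S, hS, hw0, hw1, hw2, hw3⟩ := h
  obtain ⟨T, hT, hw0', hw1', hw2', hw3'⟩ := h'
  have hx : x ∈ convexHull ℝ (M.node '' ((S ∩ T : Finset V) : Set V)) := by
    rw [← M.conforming S hS T hT]
    exact ⟨M.mem_convexHull_node_iff.2 ⟨w, hw0, hw1, hw2, hw3⟩,
      M.mem_convexHull_node_iff.2 ⟨w', hw0', hw1', hw2', hw3'⟩⟩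
  obtain ⟨u, -, hu1, hu2, hu3⟩ := M.mem_convexHull_node_iff.1 hx
  have e1 := M.weights_unique hS hw1 (fun v hv => hu1 v fun h => hv (Finset.mem_inter.1 h).1)
    (hw2.trans hu2.symm) (hw3.trans hu3.symm)
  have e2 := M.weights_unique hT hw1' (fun v hv => hu1 v fun h => hv (Finset.mem_inter.1 h).2)
    (hw2'.trans hu2.symm) (hw3'.trans hu3.symm)
  rw [e1, e2]

theorem hat_eq_of_isBary {w : V → ℝ} {x : Plane} (h : M.IsBary w x) (i : V) :
    M.hat i x = w i := by
  have hex : ∃ w : V → ℝ, M.IsBary w x := ⟨w, h⟩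
  rw [hat, dif_pos hex, M.isBary_unique hex.choose_spec h]

theorem isBary_hat {T : Finset V} (hT : T ∈ M.elems) {x : Plane} (hx : x ∈ M.cell T) :
    (∀ v, 0 ≤ M.hat v x) ∧ (∀ v, v ∉ T → M.hat v x = 0) ∧
    ∑ v, M.hat v x = 1 ∧ ∑ v, M.hat v x • M.node v = x := by
  obtain ⟨w, hw⟩ := M.mem_convexHull_node_iff.1 hx
  have h : (fun v => M.hat v x) = w := funext fun v => M.hat_eq_of_isBary ⟨T, hT, hw⟩ v
  rw [← h] at hw
  exact hw

theorem hat_nonneg (i : V) (x : Plane) : 0 ≤ M.hat i x := by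
  rw [hat]
  split_ifs with h
  · obtain ⟨T, -, h0, -⟩ := h.choose_spec
    exact h0 i
  · exact le_rfl

theorem hat_le_one (i : V) (x : Plane) : M.hat i x ≤ 1 := by
  rw [hat]
  split_ifs with h
  · obtain ⟨T, -, h0, -, h2, -⟩ := h.choose_spec
    rw [← h2]
    exact Finset.single_le_sum (fun v _ => h0 v) (Finset.mem_univ i)
  · exact zero_le_one

theorem node_mem_cell {T : Finset V} {i : V} (hi : i ∈ T) : M.node i ∈ M.cell T :=
  subset_convexHull _ _ (mem_image_of_mem _ hi)

theorem hat_node (i j : V) : M.hat i (M.node j) = if i = j then 1 else 0 := by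
  obtain ⟨T, hT, hj⟩ := M.exists_elem j
  refine M.hat_eq_of_isBary (w := fun v => if v = j then 1 else 0) ⟨T, hT, ?_, ?_, ?_, ?_⟩ i
  · intro v; dsimp only; split_ifs <;> norm_num
  · intro v hv; exact if_neg (by rintro rfl; exact hv hj)
  · simp
  · simp

theorem eq_sum_hat {u : Plane → ℝ} (hu : u ∈ M.discreteSpace) (x : Plane) :
    u x = ∑ v, u (M.node v) * M.hat v x := by
  induction hu using Submodule.span_induction with
  | mem u hu =>
    obtain ⟨i, rfl⟩ := hu
    simp [M.hat_node]
  | zero => simp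
  | add u v _ _ hu hv => simp only [Pi.add_apply, add_mul, Finset.sum_add_distrib, ← hu, ← hv]
  | smul c u _ hu =>
    simp only [Pi.smul_apply, smul_eq_mul, mul_assoc, ← Finset.mul_sum, ← hu]

theorem eq_triple_of_mem {T : Finset V} (hT : T ∈ M.elems) {i j : V} (hi : i ∈ T) (hj : j ∈ T)
    (hij : i ≠ j) : ∃ k, i ≠ k ∧ j ≠ k ∧ T = {i, j, k} := by
  have h1 : ((T.erase i).erase j).card = 1 := by
    rw [Finset.card_erase_of_mem (Finset.mem_erase.2 ⟨hij.symm, hj⟩), Finset.card_erase_of_mem hi,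
      M.card_elem T hT]
  obtain ⟨k, hk⟩ := Finset.card_eq_one.1 h1
  have hk' : k ∈ (T.erase i).erase j := by rw [hk]; simp
  simp only [Finset.mem_erase] at hk'
  refine ⟨k, hk'.2.1.symm, hk'.1.symm, ?_⟩
  rw [← Finset.insert_erase hi, ← Finset.insert_erase (Finset.mem_erase.2 ⟨hij.symm, hj⟩), hk]

theorem eq_triple_of_mem_left {T : Finset V} (hT : T ∈ M.elems) {i : V} (hi : i ∈ T) :
    ∃ j k, i ≠ j ∧ i ≠ k ∧ j ≠ k ∧ T = {i, j, k} := by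
  obtain ⟨j, hj, hji⟩ := Finset.exists_mem_ne (by rw [M.card_elem T hT]; norm_num) i
  obtain ⟨k, hik, hjk, h⟩ := M.eq_triple_of_mem hT hi hj hji.symm
  exact ⟨j, k, hji.symm, hik, hjk, h⟩

theorem cross_ne_zero {i j k : V} (hT : {i, j, k} ∈ M.elems) (hij : i ≠ j) (hik : i ≠ k)
    (hjk : j ≠ k) : cross (M.node j - M.node i) (M.node k - M.node i) ≠ 0 := by
  refine cross_ne_zero_of_independent fun α β γ h1 h2 => ?_
  have h := M.weights_unique hT
    (w := fun v => if v = i then α else if v = j then β else if v = k then γ else 0)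
    (w' := fun _ => 0) (fun v hv => by simp at hv; simp [hv]) (fun _ _ => rfl)
  have e : ∀ v, (if v = i then α else if v = j then β else if v = k then γ else 0) =
      (if v = i then α else 0) + (if v = j then β else 0) + (if v = k then γ else 0) := by
    intro v
    by_cases hi : v = i
    · subst hi; simp [hij, hik]
    · by_cases hj : v = j
      · subst hj; simp [hi, hjk]
      · simp [hi, hj]
  simp only [e, add_smul, Finset.sum_add_distrib, ite_smul, zero_smul, Finset.sum_ite_eq',
    Finset.mem_univ, if_true, Finset.sum_const_zero, h1, h2, forall_const] at h
  have hj := congrFun h j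
  have hk := congrFun h k
  simp only [hij.symm, hik.symm, hjk, hjk.symm, if_true, if_false, zero_add, add_zero] at hj hk
  exact ⟨hj, hk⟩

theorem cell_triple (i j k : V) :
    M.cell {i, j, k} = convexHull ℝ {M.node i, M.node j, M.node k} := by
  simp [cell, image_insert_eq]

theorem hat_eq_bcoord {i j k : V} (hT : {i, j, k} ∈ M.elems) (hij : i ≠ j) (hik : i ≠ k)
    (hjk : j ≠ k) {x : Plane} (hx : x ∈ M.cell {i, j, k}) :
    M.hat i x = bcoord (M.node i) (M.node j) (M.node k) x := by
  have hc := M.cross_ne_zero hT hij hik hjk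
  obtain ⟨-, h1, h2, h3⟩ := M.isBary_hat hT hx
  rw [← Finset.sum_subset (Finset.subset_univ {i, j, k}) (fun v _ hv => h1 v hv),
    Finset.sum_insert (by simp [hij, hik]), Finset.sum_pair hjk, ← add_assoc] at h2
  rw [← Finset.sum_subset (Finset.subset_univ {i, j, k})
      (fun v _ hv => by rw [h1 v hv, zero_smul]),
    Finset.sum_insert (by simp [hij, hik]), Finset.sum_pair hjk, ← add_assoc] at h3
  rw [← bcoord_combo hc h2, h3]

/-- The constant gradient of `φ_i` on the element `T`. -/
def slope (T : Finset V) (i : V) : Plane :=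
  open Classical in
  if h : ∃ j k, i ≠ j ∧ i ≠ k ∧ j ≠ k ∧ T = {i, j, k} then
    bgrad (M.node i) (M.node h.choose) (M.node h.choose_spec.choose)
  else 0

theorem slope_of_notMem {T : Finset V} {i : V} (hi : i ∉ T) : M.slope T i = 0 := by
  rw [slope, dif_neg]
  rintro ⟨j, k, -, -, -, rfl⟩
  simp at hi

theorem slope_triple {i j k : V} (hij : i ≠ j) (hik : i ≠ k)
    (hjk : j ≠ k) : M.slope {i, j, k} i = bgrad (M.node i) (M.node j) (M.node k) := by
  have key : ∀ j' k', (i ≠ j' ∧ i ≠ k' ∧ j' ≠ k' ∧ ({i, j, k} : Finset V) = {i, j', k'}) →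
      bgrad (M.node i) (M.node j') (M.node k') = bgrad (M.node i) (M.node j) (M.node k) := by
    rintro j' k' ⟨h1, h2, h3, h4⟩
    have hj' : j' ∈ ({i, j, k} : Finset V) := by rw [h4]; simp
    have hk' : k' ∈ ({i, j, k} : Finset V) := by rw [h4]; simp
    simp only [Finset.mem_insert, Finset.mem_singleton, h1.symm, h2.symm, false_or] at hj' hk'
    rcases hj' with rfl | rfl <;> rcases hk' with rfl | rfl
    · exact absurd rfl h3
    · rfl
    · exact bgrad_swap _ _ _
    · exact absurd rfl h3
  have h : ∃ j' k', i ≠ j' ∧ i ≠ k' ∧ j' ≠ k' ∧ ({i, j, k} : Finset V) = {i, j', k'} :=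
    ⟨j, k, hij, hik, hjk, rfl⟩
  rw [slope, dif_pos h]
  exact key _ _ h.choose_spec.choose_spec

/-- The differentiated partition of unity, the source of the vanishing column sums. -/
theorem sum_slope {T : Finset V} (hT : T ∈ M.elems) : ∑ v, M.slope T v = 0 := by
  rw [← Finset.sum_subset (Finset.subset_univ T) (fun v _ hv => M.slope_of_notMem hv)]
  obtain ⟨i, j, k, hij, hik, hjk, rfl⟩ := Finset.card_eq_three.1 (M.card_elem T hT)
  rw [Finset.sum_insert (by simp [hij, hik]), Finset.sum_pair hjk, M.slope_triple hij hik hjk]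
  nth_rewrite 1 [← triple_rotate i j k]
  rw [M.slope_triple hjk hij.symm hik.symm, ← triple_rotate i j k, ← triple_rotate j k i,
    M.slope_triple hik.symm hjk.symm hij, ← add_assoc]
  exact bgrad_sum _ _ _

theorem hasGradientAt_hat {T : Finset V} (hT : T ∈ M.elems) {x : Plane}
    (hx : x ∈ interior (M.cell T)) (i : V) : HasGradientAt (M.hat i) (M.slope T i) x := by
  have hn : M.cell T ∈ 𝓝 x := mem_interior_iff_mem_nhds.1 hx
  by_cases hi : i ∈ T
  · obtain ⟨j, k, hij, hik, hjk, rfl⟩ := M.eq_triple_of_mem_left hT hi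
    rw [M.slope_triple hij hik hjk]
    refine (hasGradientAt_bcoord _ _ _ x).congr_of_eventuallyEq ?_
    filter_upwards [hn] with y hy using M.hat_eq_bcoord hT hij hik hjk hy
  · rw [M.slope_of_notMem hi]
    refine (hasGradientAt_const x (0 : ℝ)).congr_of_eventuallyEq ?_
    filter_upwards [hn] with y hy using (M.isBary_hat hT hy).2.1 i hi

theorem gradient_discrete {T : Finset V} (hT : T ∈ M.elems) {x : Plane}
    (hx : x ∈ interior (M.cell T)) {u : Plane → ℝ} (hu : u ∈ M.discreteSpace) :
    gradient u x = ∑ v, u (M.node v) • M.slope T v := by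
  apply HasGradientAt.gradient
  have h1 : u = fun x => ∑ v, u (M.node v) * M.hat v x := funext (M.eq_sum_hat hu)
  rw [hasGradientAt_iff_hasFDerivAt, map_sum]
  nth_rewrite 1 [h1]
  refine HasFDerivAt.fun_sum fun v _ => ?_
  have := (M.hasGradientAt_hat hT hx v).hasFDerivAt.const_mul (u (M.node v))
  simpa using this

theorem area_mul_inner_slope {i j k : V} (hT : {i, j, k} ∈ M.elems) (hij : i ≠ j) (hik : i ≠ k)
    (hjk : j ≠ k) : M.area {i, j, k} * inner ℝ (M.slope {i, j, k} i) (M.slope {i, j, k} j) =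
      -Real.cot (EuclideanGeometry.angle (M.node i) (M.node k) (M.node j)) / 2 := by
  have hc := M.cross_ne_zero hT hij hik hjk
  rw [area, M.cell_triple, volume_triangle hc, M.slope_triple hij hik hjk, ← triple_rotate i j k,
    M.slope_triple hjk hij.symm hik.symm, inner_bgrad hc]

theorem area_pos {T : Finset V} (hT : T ∈ M.elems) : 0 < M.area T := by
  obtain ⟨i, j, k, hij, hik, hjk, rfl⟩ := Finset.card_eq_three.1 (M.card_elem T hT)
  have hc := M.cross_ne_zero hT hij hik hjk
  rw [area, M.cell_triple, volume_triangle hc]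
  have := abs_pos.2 hc
  positivity

theorem isCompact_cell (T : Finset V) : IsCompact (M.cell T) :=
  (T.finite_toSet.image _).isCompact_convexHull ℝ

theorem measurableSet_cell (T : Finset V) : MeasurableSet (M.cell T) :=
  (M.isCompact_cell T).measurableSet

theorem integral_hat {T : Finset V} (hT : T ∈ M.elems) {i : V} (hi : i ∈ T) :
    ∫ x in M.cell T, M.hat i x = M.area T / 3 := by
  obtain ⟨j, k, hij, hik, hjk, rfl⟩ := M.eq_triple_of_mem_left hT hi
  rw [setIntegral_congr_fun (M.measurableSet_cell _)
    (fun x hx => M.hat_eq_bcoord hT hij hik hjk hx), area, M.cell_triple,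
    integral_bcoord (M.cross_ne_zero hT hij hik hjk)]

theorem integral_hat_mul_hat {T : Finset V} (hT : T ∈ M.elems) {i j : V} (hi : i ∈ T)
    (hj : j ∈ T) (hij : i ≠ j) : ∫ x in M.cell T, M.hat i x * M.hat j x = M.area T / 12 := by
  obtain ⟨k, hik, hjk, rfl⟩ := M.eq_triple_of_mem hT hi hj hij
  have h : ∀ x ∈ M.cell {i, j, k}, M.hat i x * M.hat j x =
      bcoord (M.node i) (M.node j) (M.node k) x * bcoord (M.node j) (M.node k) (M.node i) x := by
    intro x hx
    rw [M.hat_eq_bcoord hT hij hik hjk hx,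
      M.hat_eq_bcoord (by rwa [triple_rotate i j k]) hjk hij.symm hik.symm
        (by rwa [triple_rotate i j k])]
  rw [setIntegral_congr_fun (M.measurableSet_cell _) h, area, M.cell_triple,
    integral_bcoord_mul_bcoord (M.cross_ne_zero hT hij hik hjk)]

theorem continuousOn_hat {T : Finset V} (hT : T ∈ M.elems) (i : V) :
    ContinuousOn (M.hat i) (M.cell T) := by
  by_cases hi : i ∈ T
  · obtain ⟨j, k, hij, hik, hjk, rfl⟩ := M.eq_triple_of_mem_left hT hi
    exact (continuous_bcoord _ _ _).continuousOn.congr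
      fun x hx => M.hat_eq_bcoord hT hij hik hjk hx
  · exact (continuousOn_const (c := (0 : ℝ))).congr fun x hx => (M.isBary_hat hT hx).2.1 i hi

theorem volume_cell_inter {S T : Finset V} (hS : S ∈ M.elems) (hT : T ∈ M.elems) (h : S ≠ T) :
    volume (M.cell S ∩ M.cell T) = 0 := by
  rw [cell, cell, M.conforming S hS T hT]
  apply volume_convexHull_image_eq_zero
  by_contra! hc
  have h1 : S ∩ T = S := Finset.eq_of_subset_of_card_le Finset.inter_subset_left
    (by rw [M.card_elem S hS]; omega)
  have h2 : S ∩ T = T := Finset.eq_of_subset_of_card_le Finset.inter_subset_right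
    (by rw [M.card_elem T hT]; omega)
  exact h (h1.symm.trans h2)

theorem volume_frontier (M : Triangulation V Ω) : volume (frontier Ω) = 0 := by
  obtain ⟨B, -, hB⟩ := M.frontier_eq
  rw [hB]
  refine (measure_biUnion_null_iff B.to_countable).2 fun e _ => ?_
  have := volume_convexHull_image_eq_zero M.node (s := {e.1, e.2}) Finset.card_le_two
  rwa [Finset.coe_pair, image_pair, convexHull_pair] at this

theorem cell_subset_closure {T : Finset V} (hT : T ∈ M.elems) : M.cell T ⊆ closure Ω := by
  rw [M.closure_eq]
  exact subset_biUnion_of_mem (u := fun T : Finset V => convexHull ℝ (M.node '' (T : Set V))) hT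

/-- Elements lie only in the closure of `Ω`, but the boundary, being a union of edges, is a null
set. So properties that hold almost everywhere in `Ω` pass to elements. -/
theorem restrict_cell_le {T : Finset V} (hT : T ∈ M.elems) :
    volume.restrict (M.cell T) ≤ volume.restrict Ω := by
  apply Measure.restrict_mono_ae
  have : ∀ᵐ x ∂(volume : Measure Plane), x ∉ frontier Ω :=
    measure_eq_zero_iff_ae_notMem.1 M.volume_frontier
  filter_upwards [this] with x hx hxT
  by_contra hxΩ
  exact hx ⟨M.cell_subset_closure hT hxT, fun h => hxΩ (interior_subset h)⟩

theorem ae_mem_interior_cell (T : Finset V) :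
    ∀ᵐ x ∂volume.restrict (M.cell T), x ∈ interior (M.cell T) := by
  rw [ae_restrict_iff' (M.measurableSet_cell T)]
  have : ∀ᵐ x ∂(volume : Measure Plane), x ∉ frontier (M.cell T) :=
    measure_eq_zero_iff_ae_notMem.1 ((convex_convexHull ℝ _).addHaar_frontier volume)
  filter_upwards [this] with x hx hxT
  by_contra h
  exact hx ⟨subset_closure hxT, h⟩

theorem mem_patch {i j : V} {T : Finset V} : T ∈ M.patch i j ↔ T ∈ M.elems ∧ i ∈ T ∧ j ∈ T :=
  Finset.mem_filter

theorem patch_comm (i j : V) : M.patch i j = M.patch j i := by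
  ext T; rw [mem_patch, mem_patch]; tauto

theorem integral_omega {f : Plane → ℝ} {i j : V}
    (hf : ∀ T ∈ M.elems, IntegrableOn f (M.cell T)) :
    ∫ x in M.omega i j, f x = ∑ T ∈ M.patch i j, ∫ x in M.cell T, f x := by
  have hom : M.omega i j = ⋃ T : M.patch i j, M.cell T := by
    ext x; simp [omega]
  rw [hom, integral_iUnion_ae (s := fun T : M.patch i j => M.cell T)
      (fun T => (M.measurableSet_cell T).nullMeasurableSet), tsum_fintype,
    Finset.sum_coe_sort (M.patch i j) fun T => ∫ x in M.cell T, f x]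
  · intro S T hST
    exact M.volume_cell_inter (M.mem_patch.1 S.2).1 (M.mem_patch.1 T.2).1
      (fun h => hST (Subtype.ext h))
  · rw [integrableOn_finite_iUnion]
    exact fun T => hf T (M.mem_patch.1 T.2).1

/-- Were `k` and `l` on the same side of the common edge, a point slightly off its midpoint towards
`l` would lie in both triangles but not on the edge, against conformity. -/
theorem opposite_sides {i j k l : V} (hS : {i, j, k} ∈ M.elems) (hT : {i, j, l} ∈ M.elems)
    (hij : i ≠ j) (hik : i ≠ k) (hjk : j ≠ k) (hil : i ≠ l) (hjl : j ≠ l) (hkl : k ≠ l) :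
    cross (M.node j - M.node i) (M.node k - M.node i) *
      cross (M.node j - M.node i) (M.node l - M.node i) < 0 := by
  have hk := M.cross_ne_zero hS hij hik hjk
  have hl := M.cross_ne_zero hT hij hil hjl
  by_contra! hge
  have hpos := lt_of_le_of_ne hge (mul_ne_zero hk hl).symm
  set a := M.node i
  set b := M.node j
  set c := M.node k
  set d := M.node l
  set α := bcoord a b c d
  set β := bcoord b c a d
  set γ := bcoord c a b d with hγ
  have hsum : α + β + γ = 1 := bcoord_sum hk d
  have hrep : α • a + β • b + γ • c = d := bcoord_reproduce hk d
  have hγ0 : 0 < γ := by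
    have : cross (a - d) (b - d) = cross (b - a) (d - a) := by
      simp only [cross, PiLp.sub_apply]; ring
    rw [hγ, bcoord, cross_rotate b c a, cross_rotate a b c, this]
    exact div_pos_iff.2 ((mul_pos_iff.1 hpos).imp And.symm And.symm)
  -- So small that `τ`, `τ|α|` and `τ|β|` are at most `1/4`; then `(1 - τ)/2 ≥ 3/8` dominates the
  -- possibly negative terms `τα` and `τβ`.
  set τ := 1 / (4 * (1 + |α| + |β|)) with hτ
  have hden : 0 < 1 + |α| + |β| := by positivity
  have hτ0 : 0 < τ := by positivity
  have hτ1 : τ * (1 + |α| + |β|) = 1 / 4 := by rw [hτ]; field_simp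
  have hτα : 0 ≤ τ * |α| := by positivity
  have hτβ : 0 ≤ τ * |β| := by positivity
  have hα : -(τ * |α|) ≤ τ * α := by
    have := mul_le_mul_of_nonneg_left (neg_abs_le α) hτ0.le; linarith
  have hβ : -(τ * |β|) ≤ τ * β := by
    have := mul_le_mul_of_nonneg_left (neg_abs_le β) hτ0.le; linarith
  set x : Plane := ((1 - τ) / 2) • a + ((1 - τ) / 2) • b + τ • d with hx
  have hxT : x ∈ M.cell {i, j, l} := by
    rw [M.cell_triple, mem_convexHull_triple]
    exact ⟨(1 - τ) / 2, (1 - τ) / 2, τ, by linarith, by linarith, hτ0.le, by ring, rfl⟩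
  have hxS : x ∈ M.cell {i, j, k} := by
    rw [M.cell_triple, mem_convexHull_triple]
    refine ⟨(1 - τ) / 2 + τ * α, (1 - τ) / 2 + τ * β, τ * γ, by linarith, by linarith,
      by positivity, by linear_combination τ * hsum, ?_⟩
    change _ = ((1 - τ) / 2) • a + ((1 - τ) / 2) • b + τ • d
    rw [← hrep]
    module
  have hmem : x ∈ convexHull ℝ (M.node '' (({i, j, k} ∩ {i, j, l} : Finset V) : Set V)) := by
    rw [← M.conforming _ hS _ hT]; exact ⟨hxS, hxT⟩
  have hint : ({i, j, k} ∩ {i, j, l} : Finset V) = {i, j} := by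
    ext v
    simp only [Finset.mem_inter, Finset.mem_insert, Finset.mem_singleton]
    constructor
    · rintro ⟨h | h | h, h' | h' | h'⟩ <;> first | tauto | exact absurd (h.symm.trans h') hkl
    · tauto
  rw [hint, Finset.coe_pair, image_pair, convexHull_pair] at hmem
  obtain ⟨s, t, -, -, hst, hxe⟩ := hmem
  have h0 : cross (b - a) (x - a) = 0 := by
    obtain rfl : s = 1 - t := by linarith
    rw [← hxe]
    simp only [cross, PiLp.sub_apply, PiLp.add_apply, PiLp.smul_apply, smul_eq_mul]
    ring
  have h1 : cross (b - a) (x - a) = τ * cross (b - a) (d - a) := by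
    simp only [hx, cross, PiLp.sub_apply, PiLp.add_apply, PiLp.smul_apply, smul_eq_mul]
    ring
  exact mul_ne_zero hτ0.ne' hl (h1.symm.trans h0)

/-- Three third vertices cannot lie pairwise on opposite sides of a line: the product of the three
pairwise products would be negative, yet it is a square. -/
theorem card_patch_le {i j : V} (hij : i ≠ j) : (M.patch i j).card ≤ 2 := by
  by_contra! h
  obtain ⟨S, T, U, hS, hT, hU, hST, hSU, hTU⟩ := Finset.two_lt_card_iff.1 h
  obtain ⟨hS, hiS, hjS⟩ := M.mem_patch.1 hS
  obtain ⟨hT, hiT, hjT⟩ := M.mem_patch.1 hT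
  obtain ⟨hU, hiU, hjU⟩ := M.mem_patch.1 hU
  obtain ⟨k, hik, hjk, rfl⟩ := M.eq_triple_of_mem hS hiS hjS hij
  obtain ⟨l, hil, hjl, rfl⟩ := M.eq_triple_of_mem hT hiT hjT hij
  obtain ⟨m, him, hjm, rfl⟩ := M.eq_triple_of_mem hU hiU hjU hij
  have h1 := M.opposite_sides hS hT hij hik hjk hil hjl (by rintro rfl; exact hST rfl)
  have h2 := M.opposite_sides hT hU hij hil hjl him hjm (by rintro rfl; exact hTU rfl)
  have h3 := M.opposite_sides hS hU hij hik hjk him hjm (by rintro rfl; exact hSU rfl)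
  have h4 := mul_neg_of_pos_of_neg (mul_pos_of_neg_of_neg h1 h2) h3
  have : ∀ a b c : ℝ, a * b * (b * c) * (a * c) = (a * b * c) ^ 2 := by intros; ring
  rw [this] at h4
  exact absurd h4 (not_lt.2 (sq_nonneg _))

end Triangulation

/-! ### Measurability and bounds of the coefficients along discrete functions. -/

theorem aemeasurable_comp_caratheodory {α : Type*} [MeasurableSpace α] {μ : Measure α}
    {f : α → ℝ → ℝ} (hm : ∀ η, AEMeasurable (fun x => f x η) μ)
    (hc : ∀ᵐ x ∂μ, Continuous (f x)) {v : α → ℝ} (hv : AEMeasurable v μ) :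
    AEMeasurable (fun x => f x (v x)) μ := by
  suffices h : ∀ w : α → ℝ, Measurable w → AEMeasurable (fun x => f x (w x)) μ by
    refine (h _ hv.measurable_mk).congr ?_
    filter_upwards [hv.ae_eq_mk] with x hx
    rw [hx]
  intro w hw
  have hs := hw.stronglyMeasurable
  refine aemeasurable_of_tendsto_metrizable_ae atTop (f := fun n x => f x (hs.approx n x))
    (fun n => ?_) ?_
  -- Along a simple function only finitely many values `η` occur; continuity in `η` then passes to
  -- the limit.
  · have : (fun x => f x (hs.approx n x)) = fun x => ∑ η ∈ (hs.approx n).range,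
        (hs.approx n ⁻¹' {η}).indicator (fun x => f x η) x := by
      ext x
      rw [Finset.sum_eq_single_of_mem (hs.approx n x) (SimpleFunc.mem_range_self _ x)]
      · simp
      · intro η _ hη
        exact indicator_of_notMem (s := hs.approx n ⁻¹' {η}) (f := fun x => f x η)
          (fun h => hη (mem_singleton_iff.1 h).symm)
    rw [this]
    refine Finset.aemeasurable_fun_sum _ fun η _ => ?_
    exact (hm η).indicator ((hs.approx n).measurableSet_fiber η)
  · filter_upwards [hc] with x hx
    exact (hx.tendsto _).comp (hs.tendsto_approx x)

theorem aemeasurable_deriv_param {α : Type*} [MeasurableSpace α] {μ : Measure α}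
    {f : α → ℝ → ℝ} (hm : ∀ η, AEMeasurable (fun x => f x η) μ)
    (hd : ∀ᵐ x ∂μ, Differentiable ℝ (f x)) (η : ℝ) :
    AEMeasurable (fun x => deriv (f x) η) μ := by
  have hlim : Tendsto (fun n : ℕ => 1 / ((n : ℝ) + 1)) atTop (𝓝[≠] 0) :=
    tendsto_nhdsWithin_iff.2 ⟨tendsto_one_div_add_atTop_nhds_zero_nat,
      Eventually.of_forall fun n => by
        have : (0 : ℝ) < 1 / ((n : ℝ) + 1) := by positivity
        exact this.ne'⟩
  refine aemeasurable_of_tendsto_metrizable_ae atTop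
    (f := fun (n : ℕ) x => (1 / ((n : ℝ) + 1))⁻¹ • (f x (η + 1 / ((n : ℝ) + 1)) - f x η))
    (fun n => ((hm (η + 1 / ((n : ℝ) + 1))).sub (hm η)).const_smul (1 / ((n : ℝ) + 1))⁻¹) ?_
  filter_upwards [hd] with x hx
  exact (hasDerivAt_iff_tendsto_slope_zero.1 (hx η).hasDerivAt).comp hlim

/-- The integrand is a Carathéodory function of the pair `(x, t)`, hence measurable on the product,
and integrating out `t` preserves measurability. -/
theorem aemeasurable_meanDeriv {μ : Measure Plane} [SFinite μ] {f : Plane → ℝ → ℝ}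
    (hm : ∀ η, AEMeasurable (fun x => f x η) μ) (hd : ∀ᵐ x ∂μ, ContDiff ℝ 1 (f x))
    {u₁ u₂ : Plane → ℝ} (h₁ : AEMeasurable u₁ μ) (h₂ : AEMeasurable u₂ μ) :
    AEMeasurable (meanDeriv f u₁ u₂) μ := by
  have hmd := aemeasurable_deriv_param hm (hd.mono fun x hx => hx.differentiable one_ne_zero)
  have key : AEMeasurable (fun p : Plane × ℝ =>
      deriv (f p.1) (p.2 * u₁ p.1 + (1 - p.2) * u₂ p.1))
      (μ.prod (volume.restrict (Ioc (0 : ℝ) 1))) := by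
    refine aemeasurable_comp_caratheodory (f := fun p : Plane × ℝ => deriv (f p.1))
      (fun η => (hmd η).comp_quasiMeasurePreserving Measure.quasiMeasurePreserving_fst) ?_ ?_
    · exact Measure.quasiMeasurePreserving_fst.ae
        (hd.mono fun x hx => hx.continuous_deriv le_rfl)
    · have e₁ := h₁.comp_quasiMeasurePreserving
        (Measure.quasiMeasurePreserving_fst (μ := μ) (ν := volume.restrict (Ioc (0 : ℝ) 1)))
      have e₂ := h₂.comp_quasiMeasurePreserving
        (Measure.quasiMeasurePreserving_fst (μ := μ) (ν := volume.restrict (Ioc (0 : ℝ) 1)))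
      exact (measurable_snd.aemeasurable.mul e₁).add
        ((measurable_const.sub measurable_snd).aemeasurable.mul e₂)
  have := key.aestronglyMeasurable.integral_prod_right'
  refine this.aemeasurable.congr (Eventually.of_forall fun x => ?_)
  simp only [meanDeriv, intervalIntegral.integral_of_le zero_le_one]

theorem abs_meanDeriv_le {f : Plane → ℝ → ℝ} {u₁ u₂ : Plane → ℝ} {x : Plane} {K : ℝ}
    (h : ∀ η, |deriv (f x) η| ≤ K) : |meanDeriv f u₁ u₂ x| ≤ K := by
  have := intervalIntegral.norm_integral_le_of_norm_le_const (a := (0 : ℝ)) (b := 1)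
    (f := fun t => deriv (f x) (t * u₁ x + (1 - t) * u₂ x)) (C := K) fun t _ => h _
  simpa [meanDeriv] using this

theorem meanDeriv_nonneg {f : Plane → ℝ → ℝ} {u₁ u₂ : Plane → ℝ} {x : Plane}
    (h : ∀ η, 0 ≤ deriv (f x) η) : 0 ≤ meanDeriv f u₁ u₂ x :=
  intervalIntegral.integral_nonneg zero_le_one fun _ _ => h _

theorem cot_nonneg {θ : ℝ} (h0 : 0 ≤ θ) (h : θ ≤ Real.pi / 2) : 0 ≤ Real.cot θ := by
  rw [Real.cot_eq_cos_div_sin]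
  exact div_nonneg (Real.cos_nonneg_of_neg_pi_div_two_le_of_le (by linarith [Real.pi_pos]) h)
    (Real.sin_nonneg_of_nonneg_of_le_pi h0 (by linarith [Real.pi_pos]))

/-! ### Elementwise assembly and estimates of the matrix entries. -/

namespace Triangulation

variable {V : Type*} [Fintype V] [DecidableEq V] {Ω : Set Plane} (M : Triangulation V Ω)

/-- The gradient on the element `T` of a discrete function. -/
def discGrad (u : Plane → ℝ) (T : Finset V) : Plane := ∑ v, u (M.node v) • M.slope T v

/-- The contribution of the element `T` to the diffusion and convection part of the entry with
test function `φ_i` and trial function `φ_j`. -/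
def elemDiffConv (κ : Plane → ℝ → ℝ) (u₁ u₂ : Plane → ℝ) (T : Finset V) (i j : V) : ℝ :=
  (∫ x in M.cell T, κ x (u₁ x)) * inner ℝ (M.slope T j) (M.slope T i) +
    inner ℝ (M.discGrad u₂ T) (M.slope T i) *
      ∫ x in M.cell T, meanDeriv κ u₁ u₂ x * M.hat j x

/-- The reaction part of the matrix. -/
def massEntry (g : Plane → ℝ → ℝ) (u₁ u₂ : Plane → ℝ) (i j : V) : ℝ :=
  ∫ x in M.omega i j, meanDeriv g u₁ u₂ x * M.hat j x * M.hat i x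

theorem aemeasurable_hat {T : Finset V} (hT : T ∈ M.elems) (i : V) :
    AEMeasurable (M.hat i) (volume.restrict (M.cell T)) :=
  (M.continuousOn_hat hT i).aemeasurable (M.measurableSet_cell T)

theorem aemeasurable_discrete {T : Finset V} (hT : T ∈ M.elems) {u : Plane → ℝ}
    (hu : u ∈ M.discreteSpace) : AEMeasurable u (volume.restrict (M.cell T)) := by
  rw [show u = fun x => ∑ v, u (M.node v) * M.hat v x from funext (M.eq_sum_hat hu)]
  exact Finset.aemeasurable_fun_sum _ fun v _ => (M.aemeasurable_hat hT v).const_mul _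

instance isFiniteMeasure_restrict_cell (T : Finset V) :
    IsFiniteMeasure (volume.restrict (M.cell T)) :=
  ⟨by rw [Measure.restrict_apply_univ]; exact (M.isCompact_cell T).measure_lt_top⟩

theorem ae_cell {T : Finset V} (hT : T ∈ M.elems) {p : Plane → Prop}
    (h : ∀ᵐ x ∂volume.restrict Ω, p x) : ∀ᵐ x ∂volume.restrict (M.cell T), p x :=
  ae_mono (M.restrict_cell_le hT) h

section Coefficients

variable {κ g : Plane → ℝ → ℝ} {kα kβ Kη Gη : ℝ} {u₁ u₂ : Plane → ℝ}

theorem integrable_diffusion (hcoef : CoefficientAssumption Ω κ g kα kβ Kη Gη)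
    (hu₁ : u₁ ∈ M.discreteSpace) {T : Finset V} (hT : T ∈ M.elems) :
    IntegrableOn (fun x => κ x (u₁ x)) (M.cell T) := by
  refine Integrable.of_bound (C := kβ) (aemeasurable_comp_caratheodory
    (fun η => (hcoef.κ_measurable η).mono_measure (M.restrict_cell_le hT))
    (M.ae_cell hT (hcoef.κ_contDiff.mono fun x hx => hx.continuous))
    (M.aemeasurable_discrete hT hu₁)).aestronglyMeasurable ?_
  filter_upwards [M.ae_cell hT hcoef.κ_bounds] with x hx
  rw [Real.norm_eq_abs, abs_of_nonneg (hcoef.kα_pos.le.trans (hx _).1)]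
  exact (hx _).2

theorem integrable_convection (hcoef : CoefficientAssumption Ω κ g kα kβ Kη Gη)
    (hu₁ : u₁ ∈ M.discreteSpace) (hu₂ : u₂ ∈ M.discreteSpace) {T : Finset V} (hT : T ∈ M.elems)
    (i : V) : IntegrableOn (fun x => meanDeriv κ u₁ u₂ x * M.hat i x) (M.cell T) := by
  refine Integrable.of_bound (C := Kη) ((aemeasurable_meanDeriv
    (fun η => (hcoef.κ_measurable η).mono_measure (M.restrict_cell_le hT))
    (M.ae_cell hT hcoef.κ_contDiff)
    (M.aemeasurable_discrete hT hu₁) (M.aemeasurable_discrete hT hu₂)).mul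
      (M.aemeasurable_hat hT i)).aestronglyMeasurable ?_
  filter_upwards [M.ae_cell hT hcoef.κ_deriv] with x hx
  rw [norm_mul, Real.norm_eq_abs, Real.norm_eq_abs, abs_of_nonneg (M.hat_nonneg i x)]
  exact (mul_le_mul (abs_meanDeriv_le hx) (M.hat_le_one i x) (M.hat_nonneg i x)
    hcoef.Kη_pos.le).trans_eq (mul_one _)

theorem integrable_reaction (hcoef : CoefficientAssumption Ω κ g kα kβ Kη Gη)
    (hu₁ : u₁ ∈ M.discreteSpace) (hu₂ : u₂ ∈ M.discreteSpace) {T : Finset V} (hT : T ∈ M.elems)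
    (i j : V) : IntegrableOn (fun x => meanDeriv g u₁ u₂ x * M.hat j x * M.hat i x)
      (M.cell T) := by
  refine Integrable.of_bound (C := Gη) (((aemeasurable_meanDeriv
    (fun η => (hcoef.g_measurable η).mono_measure (M.restrict_cell_le hT))
    (M.ae_cell hT hcoef.g_contDiff)
    (M.aemeasurable_discrete hT hu₁) (M.aemeasurable_discrete hT hu₂)).mul
      (M.aemeasurable_hat hT j)).mul (M.aemeasurable_hat hT i)).aestronglyMeasurable ?_
  filter_upwards [M.ae_cell hT hcoef.g_deriv] with x hx
  have hG := abs_meanDeriv_le (f := g) (u₁ := u₁) (u₂ := u₂)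
    fun η => (abs_of_nonneg (hx η).1).trans_le (hx η).2
  have hG0 := (abs_nonneg _).trans hG
  rw [norm_mul, norm_mul, Real.norm_eq_abs, Real.norm_eq_abs, Real.norm_eq_abs,
    abs_of_nonneg (M.hat_nonneg i x), abs_of_nonneg (M.hat_nonneg j x), mul_assoc]
  exact (mul_le_mul hG (mul_le_one₀ (M.hat_le_one j x) (M.hat_nonneg i x) (M.hat_le_one i x))
    (mul_nonneg (M.hat_nonneg j x) (M.hat_nonneg i x)) hG0).trans_eq (mul_one _)

theorem le_integral_diffusion (hcoef : CoefficientAssumption Ω κ g kα kβ Kη Gη)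
    (hu₁ : u₁ ∈ M.discreteSpace) {T : Finset V} (hT : T ∈ M.elems) :
    kα * M.area T ≤ ∫ x in M.cell T, κ x (u₁ x) := by
  have : kα * M.area T = ∫ _ in M.cell T, kα := by
    rw [setIntegral_const, smul_eq_mul, mul_comm]; rfl
  rw [this]
  refine integral_mono_ae (integrable_const _) (M.integrable_diffusion hcoef hu₁ hT) ?_
  filter_upwards [M.ae_cell hT hcoef.κ_bounds] with x hx using (hx _).1

theorem integrable_hat {T : Finset V} (hT : T ∈ M.elems) (i : V) :
    IntegrableOn (M.hat i) (M.cell T) :=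
  (M.continuousOn_hat hT i).integrableOn_compact (M.isCompact_cell T)

theorem abs_integral_convection_le (hcoef : CoefficientAssumption Ω κ g kα kβ Kη Gη)
    {T : Finset V} (hT : T ∈ M.elems) {i : V} (hi : i ∈ T) :
    |∫ x in M.cell T, meanDeriv κ u₁ u₂ x * M.hat i x| ≤ Kη * (M.area T / 3) := by
  rw [← M.integral_hat hT hi, ← integral_const_mul, ← Real.norm_eq_abs]
  refine norm_integral_le_of_norm_le ((M.integrable_hat hT i).const_mul _) ?_
  filter_upwards [M.ae_cell hT hcoef.κ_deriv] with x hx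
  rw [norm_mul, Real.norm_eq_abs, Real.norm_eq_abs, abs_of_nonneg (M.hat_nonneg i x)]
  exact mul_le_mul_of_nonneg_right (abs_meanDeriv_le hx) (M.hat_nonneg i x)

theorem diffConv_eq_sum (hcoef : CoefficientAssumption Ω κ g kα kβ Kη Gη)
    (hu₁ : u₁ ∈ M.discreteSpace) (hu₂ : u₂ ∈ M.discreteSpace) (i j : V) :
    M.diffConv κ u₁ u₂ i j = ∑ T ∈ M.patch i j, M.elemDiffConv κ u₁ u₂ T i j := by
  have e1 : ∀ T ∈ M.elems, (fun x => κ x (u₁ x) *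
      inner ℝ (gradient (M.hat j) x) (gradient (M.hat i) x)) =ᵐ[volume.restrict (M.cell T)]
      fun x => κ x (u₁ x) * inner ℝ (M.slope T j) (M.slope T i) := by
    intro T hT
    filter_upwards [M.ae_mem_interior_cell T] with x hx
    rw [(M.hasGradientAt_hat hT hx i).gradient, (M.hasGradientAt_hat hT hx j).gradient]
  have e2 : ∀ T ∈ M.elems, (fun x => meanDeriv κ u₁ u₂ x *
      inner ℝ (gradient u₂ x) (gradient (M.hat i) x) * M.hat j x)
      =ᵐ[volume.restrict (M.cell T)]
      fun x => inner ℝ (M.discGrad u₂ T) (M.slope T i) *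
        (meanDeriv κ u₁ u₂ x * M.hat j x) := by
    intro T hT
    filter_upwards [M.ae_mem_interior_cell T] with x hx
    rw [(M.hasGradientAt_hat hT hx i).gradient, M.gradient_discrete hT hx hu₂, discGrad]
    ring
  rw [diffConv, M.integral_omega fun T hT =>
      ((M.integrable_diffusion hcoef hu₁ hT).mul_const _).congr (e1 T hT).symm,
    M.integral_omega fun T hT =>
      ((M.integrable_convection hcoef hu₁ hu₂ hT j).const_mul _).congr (e2 T hT).symm,
    ← Finset.sum_add_distrib]
  refine Finset.sum_congr rfl fun T hT => ?_
  have hT' := (M.mem_patch.1 hT).1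
  rw [integral_congr_ae (e1 T hT'), integral_congr_ae (e2 T hT'), integral_mul_const,
    integral_const_mul, elemDiffConv]

theorem massEntry_eq_sum (hcoef : CoefficientAssumption Ω κ g kα kβ Kη Gη)
    (hu₁ : u₁ ∈ M.discreteSpace) (hu₂ : u₂ ∈ M.discreteSpace) (i j : V) :
    M.massEntry g u₁ u₂ i j = ∑ T ∈ M.patch i j,
      ∫ x in M.cell T, meanDeriv g u₁ u₂ x * M.hat j x * M.hat i x :=
  M.integral_omega fun _ hT => M.integrable_reaction hcoef hu₁ hu₂ hT i j

theorem massEntry_nonneg (hcoef : CoefficientAssumption Ω κ g kα kβ Kη Gη)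
    (hu₁ : u₁ ∈ M.discreteSpace) (hu₂ : u₂ ∈ M.discreteSpace) (i j : V) :
    0 ≤ M.massEntry g u₁ u₂ i j := by
  rw [M.massEntry_eq_sum hcoef hu₁ hu₂]
  refine Finset.sum_nonneg fun T hT => integral_nonneg_of_ae ?_
  filter_upwards [M.ae_cell (M.mem_patch.1 hT).1 hcoef.g_deriv] with x hx
  exact mul_nonneg (mul_nonneg (meanDeriv_nonneg fun η => (hx η).1) (M.hat_nonneg j x))
    (M.hat_nonneg i x)

theorem bddAbove_areas : BddAbove {a : ℝ | ∃ T ∈ M.elems, a = M.area T} := by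
  have : {a : ℝ | ∃ T ∈ M.elems, a = M.area T} = M.area '' (M.elems : Set (Finset V)) := by
    ext a; simp [eq_comm]
  rw [this]
  exact (M.elems.finite_toSet.image _).bddAbove

theorem area_le_maxArea {T : Finset V} (hT : T ∈ M.elems) : M.area T ≤ M.maxArea :=
  le_csSup M.bddAbove_areas ⟨T, hT, rfl⟩

theorem maxArea_nonneg : 0 ≤ M.maxArea :=
  Real.sSup_nonneg (by rintro a ⟨T, hT, rfl⟩; exact (M.area_pos hT).le)

/-- The product of two hat functions integrates to `|T|/12`, and an edge lies in at most two
triangles; hence the `6`. -/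
theorem massEntry_le (hcoef : CoefficientAssumption Ω κ g kα kβ Kη Gη) (hG : 0 ≤ Gη)
    (hu₁ : u₁ ∈ M.discreteSpace) (hu₂ : u₂ ∈ M.discreteSpace) {i j : V} (hij : i ≠ j) :
    M.massEntry g u₁ u₂ i j ≤ Gη * M.maxArea / 6 := by
  rw [M.massEntry_eq_sum hcoef hu₁ hu₂]
  have h : ∀ T ∈ M.patch i j, ∫ x in M.cell T, meanDeriv g u₁ u₂ x * M.hat j x * M.hat i x ≤
      Gη * M.maxArea / 12 := by
    intro T hT
    obtain ⟨hT, hi, hj⟩ := M.mem_patch.1 hT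
    calc _ ≤ ∫ x in M.cell T, Gη * (M.hat i x * M.hat j x) := by
          refine integral_mono_ae (M.integrable_reaction hcoef hu₁ hu₂ hT i j)
            (((((M.continuousOn_hat hT i).mul (M.continuousOn_hat hT j))).integrableOn_compact
              (M.isCompact_cell T)).const_mul _) ?_
          filter_upwards [M.ae_cell hT hcoef.g_deriv] with x hx
          have := (le_abs_self _).trans
            (abs_meanDeriv_le (f := g) (u₁ := u₁) (u₂ := u₂) fun η =>
              (abs_of_nonneg (hx η).1).trans_le (hx η).2)
          calc _ = meanDeriv g u₁ u₂ x * (M.hat i x * M.hat j x) := by ring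
            _ ≤ _ := mul_le_mul_of_nonneg_right this
              (mul_nonneg (M.hat_nonneg i x) (M.hat_nonneg j x))
      _ = Gη * (M.area T / 12) := by rw [integral_const_mul, M.integral_hat_mul_hat hT hi hj hij]
      _ ≤ Gη * (M.maxArea / 12) := by gcongr; exact M.area_le_maxArea hT
      _ = _ := by ring
  have hc : ((M.patch i j).card : ℝ) ≤ 2 := by exact_mod_cast M.card_patch_le hij
  calc _ ≤ (M.patch i j).card • (Gη * M.maxArea / 12) := Finset.sum_le_card_nsmul _ _ _ h
    _ = (M.patch i j).card * (Gη * M.maxArea / 12) := nsmul_eq_mul _ _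
    _ ≤ 2 * (Gη * M.maxArea / 12) := by
      have := mul_nonneg hG M.maxArea_nonneg
      gcongr
    _ = _ := by ring

/-- On each element both terms are linear in the gradient of the test function `φ_j`, and these
gradients add up to zero. The sum must run over boundary vertices too. -/
theorem sum_diffConv (hcoef : CoefficientAssumption Ω κ g kα kβ Kη Gη)
    (hu₁ : u₁ ∈ M.discreteSpace) (hu₂ : u₂ ∈ M.discreteSpace) (i : V) :
    ∑ j, M.diffConv κ u₁ u₂ j i = 0 := by
  simp only [M.diffConv_eq_sum hcoef hu₁ hu₂]
  have h : ∀ j, ∑ T ∈ M.patch j i, M.elemDiffConv κ u₁ u₂ T j i =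
      ∑ T ∈ M.elems with i ∈ T, M.elemDiffConv κ u₁ u₂ T j i := by
    intro j
    refine Finset.sum_subset (fun T hT => ?_) fun T hT hn => ?_
    · rw [mem_patch] at hT; rw [Finset.mem_filter]; exact ⟨hT.1, hT.2.2⟩
    · rw [Finset.mem_filter] at hT
      have hj : j ∉ T := fun hj => hn (M.mem_patch.2 ⟨hT.1, hj, hT.2⟩)
      simp [elemDiffConv, M.slope_of_notMem hj]
  simp only [h]
  rw [Finset.sum_comm]
  refine Finset.sum_eq_zero fun T hT => ?_
  have hT' := (Finset.mem_filter.1 hT).1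
  simp only [elemDiffConv]
  rw [Finset.sum_add_distrib, ← Finset.mul_sum, ← Finset.sum_mul, ← inner_sum, ← inner_sum,
    M.sum_slope hT', inner_zero_right, inner_zero_right]
  ring

theorem diffConv_eq_zero {i j : V} (hij : ¬ ∃ T ∈ M.elems, i ∈ T ∧ j ∈ T) {κ : Plane → ℝ → ℝ} :
    M.diffConv κ u₁ u₂ i j = 0 := by
  have : M.omega i j = ∅ := by
    simp only [omega, iUnion_eq_empty]
    intro T hT
    exact absurd ⟨T, M.mem_patch.1 hT⟩ hij
  simp [diffConv, this]

theorem massEntry_eq_zero {i j : V} (hij : ¬ ∃ T ∈ M.elems, i ∈ T ∧ j ∈ T) {g : Plane → ℝ → ℝ} :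
    M.massEntry g u₁ u₂ i j = 0 := by
  have : M.omega i j = ∅ := by
    simp only [omega, iUnion_eq_empty]
    intro T hT
    exact absurd ⟨T, M.mem_patch.1 hT⟩ hij
  simp [massEntry, this]

/-- Eliminating `|∇φ_j|²` by `sum_slope` leaves only differences of nodal values, weighted by
cotangents of the angles at `q_k` and `q_i`. This is how `patchDiff` and `cotAt` enter the
estimates. -/
theorem inner_discGrad_slope {i j k : V} (hT : {i, j, k} ∈ M.elems) (hij : i ≠ j) (hik : i ≠ k)
    (hjk : j ≠ k) (u : Plane → ℝ) :
    M.area {i, j, k} * inner ℝ (M.discGrad u {i, j, k}) (M.slope {i, j, k} j) =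
      (u (M.node j) - u (M.node i)) *
          Real.cot (EuclideanGeometry.angle (M.node i) (M.node k) (M.node j)) / 2 +
        (u (M.node j) - u (M.node k)) *
          Real.cot (EuclideanGeometry.angle (M.node j) (M.node i) (M.node k)) / 2 := by
  have hsum := M.sum_slope hT
  have hg : M.discGrad u {i, j, k} = u (M.node i) • M.slope {i, j, k} i +
      (u (M.node j) • M.slope {i, j, k} j + u (M.node k) • M.slope {i, j, k} k) := by
    rw [discGrad, ← Finset.sum_subset (Finset.subset_univ {i, j, k})
      (fun v _ hv => by rw [M.slope_of_notMem hv, smul_zero]),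
      Finset.sum_insert (by simp [hij, hik]), Finset.sum_pair hjk]
  rw [← Finset.sum_subset (Finset.subset_univ {i, j, k})
      (fun v _ hv => M.slope_of_notMem hv),
    Finset.sum_insert (by simp [hij, hik]), Finset.sum_pair hjk] at hsum
  have h1 := M.area_mul_inner_slope hT hij hik hjk
  have h2 := M.area_mul_inner_slope (i := j) (j := k) (k := i) (by rwa [triple_rotate i j k])
    hjk hij.symm hik.symm
  rw [triple_rotate i j k, real_inner_comm] at h2
  have h3 : inner ℝ (M.slope {i, j, k} i) (M.slope {i, j, k} j) +
      (inner ℝ (M.slope {i, j, k} j) (M.slope {i, j, k} j) +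
        inner ℝ (M.slope {i, j, k} k) (M.slope {i, j, k} j)) = 0 := by
    rw [← inner_add_left, ← inner_add_left, hsum, inner_zero_left]
  rw [hg, inner_add_left, inner_add_left, real_inner_smul_left, real_inner_smul_left,
    real_inner_smul_left]
  linear_combination (u (M.node i) - u (M.node j)) * h1 + (u (M.node k) - u (M.node j)) * h2 +
    u (M.node j) * M.area {i, j, k} * h3

theorem edgeDiff_le_patchDiff {u : Plane → ℝ} {i j k l : V} {T : Finset V}
    (hT : T ∈ M.patch i j) (hk : k ∈ T) (hl : l ∈ T) : M.edgeDiff u k l ≤ M.patchDiff u i j := by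
  refine le_csSup ?_ ⟨T, hT, k, hk, l, hl, rfl⟩
  refine ((Set.finite_range fun p : V × V => M.edgeDiff u p.1 p.2).subset ?_).bddAbove
  rintro d ⟨T, -, k, -, l, -, rfl⟩
  exact ⟨(k, l), rfl⟩

theorem patchDiff_nonneg (u : Plane → ℝ) (i j : V) : 0 ≤ M.patchDiff u i j :=
  Real.sSup_nonneg (by rintro d ⟨T, -, k, -, l, -, rfl⟩; exact abs_nonneg _)

/-- Nonobtuse angles make `∇φ_i · ∇φ_j` nonpositive, so the lower bound on `κ` gives an upper bound.
In the convection term the area from `∫ φ_i = |T|/3` cancels against the cotangent formula; the `6`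
is this `3` times the `2` there. -/
theorem elemDiffConv_le (hcoef : CoefficientAssumption Ω κ g kα kβ Kη Gη)
    {βm βM : ℝ} (hmesh : M.AngleCondition βm βM)
    (hu₁ : u₁ ∈ M.discreteSpace) {i j : V} (hij : i ≠ j) {T : Finset V}
    (hT : T ∈ M.patch i j) :
    M.elemDiffConv κ u₁ u₂ T j i ≤
      -(kα / 2) * ∑ k ∈ T \ {i, j},
        Real.cot (EuclideanGeometry.angle (M.node i) (M.node k) (M.node j)) +
      Kη * M.patchDiff u₂ i j / 6 * (∑ k ∈ T \ {i, j},
        Real.cot (EuclideanGeometry.angle (M.node i) (M.node k) (M.node j)) +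
        ∑ k ∈ T \ {i, j},
          Real.cot (EuclideanGeometry.angle (M.node j) (M.node i) (M.node k))) := by
  obtain ⟨hTe, hi, hj⟩ := M.mem_patch.1 hT
  obtain ⟨k, hik, hjk, rfl⟩ := M.eq_triple_of_mem hTe hi hj hij
  have hk : k ∈ ({i, j, k} : Finset V) := by simp
  have hsd : ({i, j, k} : Finset V) \ {i, j} = {k} := by
    ext v
    simp only [Finset.mem_sdiff, Finset.mem_insert, Finset.mem_singleton]
    constructor
    · tauto
    · rintro rfl; exact ⟨by simp, by rintro (h | h); exacts [hik h.symm, hjk h.symm]⟩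
  rw [hsd, Finset.sum_singleton, Finset.sum_singleton]
  have hc1 := cot_nonneg (EuclideanGeometry.angle_nonneg (M.node i) (M.node k) (M.node j))
    (hmesh.nonobtuse _ hTe i hi k hk j hj hik hjk.symm hij)
  have hc2 := cot_nonneg (EuclideanGeometry.angle_nonneg (M.node j) (M.node i) (M.node k))
    (hmesh.nonobtuse _ hTe j hj i hi k hk hij.symm hik hjk)
  set C1 := Real.cot (EuclideanGeometry.angle (M.node i) (M.node k) (M.node j))
  set C2 := Real.cot (EuclideanGeometry.angle (M.node j) (M.node i) (M.node k))
  have ha := M.area_pos hTe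
  set a := M.area {i, j, k}
  set δ := M.patchDiff u₂ i j
  have hi1 := M.area_mul_inner_slope hTe hij hik hjk
  have hi2 := M.inner_discGrad_slope hTe hij hik hjk u₂
  have hd1 : |u₂ (M.node j) - u₂ (M.node i)| ≤ δ := M.edgeDiff_le_patchDiff hT hj hi
  have hd2 : |u₂ (M.node j) - u₂ (M.node k)| ≤ δ := M.edgeDiff_le_patchDiff hT hj hk
  have hk1 := M.le_integral_diffusion hcoef hu₁ hTe
  have hb := M.abs_integral_convection_le (u₁ := u₁) (u₂ := u₂) hcoef hTe hi
  rw [elemDiffConv]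
  set B := ∫ x in M.cell {i, j, k}, meanDeriv κ u₁ u₂ x * M.hat i x
  set G := inner ℝ (M.slope {i, j, k} i) (M.slope {i, j, k} j)
  set P := inner ℝ (M.discGrad u₂ {i, j, k}) (M.slope {i, j, k} j)
  have hG : G ≤ 0 := by
    by_contra! hG
    have := mul_pos ha hG
    rw [hi1] at this
    change 0 < -C1 / 2 at this
    linarith
  have t1 : (∫ x in M.cell {i, j, k}, κ x (u₁ x)) * G ≤ -(kα / 2) * C1 := by
    calc _ ≤ kα * a * G := mul_le_mul_of_nonpos_right hk1 hG
      _ = kα * (a * G) := by ring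
      _ = _ := by rw [hi1]; ring
  have t2 : a * |P| ≤ δ * (C1 + C2) / 2 := by
    rw [← abs_of_pos ha, ← abs_mul, hi2]
    calc _ ≤ |(u₂ (M.node j) - u₂ (M.node i)) * C1 / 2| +
          |(u₂ (M.node j) - u₂ (M.node k)) * C2 / 2| := abs_add_le _ _
      _ = |u₂ (M.node j) - u₂ (M.node i)| * C1 / 2 +
          |u₂ (M.node j) - u₂ (M.node k)| * C2 / 2 := by
        rw [abs_div, abs_div, abs_mul, abs_mul, abs_of_nonneg hc1, abs_of_nonneg hc2, abs_two]
      _ ≤ δ * C1 / 2 + δ * C2 / 2 := by gcongr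
      _ = _ := by ring
  have t3 : P * B ≤ Kη * δ / 6 * (C1 + C2) := by
    calc _ ≤ |P| * |B| := by rw [← abs_mul]; exact le_abs_self _
      _ ≤ |P| * (Kη * (a / 3)) := by gcongr
      _ = Kη / 3 * (a * |P|) := by ring
      _ ≤ Kη / 3 * (δ * (C1 + C2) / 2) := by
        have := hcoef.Kη_pos
        gcongr
      _ = _ := by ring
  linarith

/-- The bound is `-(βm/2) (kα - Kη βM δ / (3 βm))`, in which the bracket is the quantity controlled
by the dominance condition. -/
theorem diffConv_le (hcoef : CoefficientAssumption Ω κ g kα kβ Kη Gη)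
    {βm βM : ℝ} (hmesh : M.AngleCondition βm βM)
    (hu₁ : u₁ ∈ M.discreteSpace) (hu₂ : u₂ ∈ M.discreteSpace) (i : M.Free) {j : V}
    (hij : M.graph.Adj i j) :
    M.diffConv κ u₁ u₂ j i ≤ -(kα / 2) * βm + Kη * M.patchDiff u₂ i j / 6 * βM := by
  have h1 := hmesh.opposite i j hij
  have h2 := hmesh.full i j hij
  have hK := hcoef.Kη_pos
  have hα := hcoef.kα_pos
  have hδ := M.patchDiff_nonneg u₂ i j
  rw [M.diffConv_eq_sum hcoef hu₁ hu₂, patch_comm]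
  refine (Finset.sum_le_sum fun T hT => M.elemDiffConv_le hcoef hmesh hu₁ hij.1 hT).trans ?_
  rw [Finset.sum_add_distrib, ← Finset.mul_sum, ← Finset.mul_sum, Finset.sum_add_distrib]
  change -(kα / 2) * M.cotOpposite i j + Kη * M.patchDiff u₂ i j / 6 *
    (M.cotOpposite i j + M.cotAt i j) ≤ _
  have e1 : kα / 2 * βm ≤ kα / 2 * M.cotOpposite i j := by gcongr
  have e2 : Kη * M.patchDiff u₂ i j / 6 * (M.cotOpposite i j + M.cotAt i j) ≤
    Kη * M.patchDiff u₂ i j / 6 * βM := by gcongr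
  linarith

end Coefficients

end Triangulation

/-! ### Weights, walks in the mesh, and the distance to the boundary. -/

theorem Finset.sum_pos_of_dominant_term {ι : Type*} [DecidableEq ι] {N : Finset ι} {f : ι → ℝ}
    {k : ι} (hk : k ∈ N) {m : ℕ} (hm : N.card ≤ m) {Y : ℝ} (hY : 0 < Y) (hfk : m * Y ≤ f k)
    (hf : ∀ j ∈ N, -Y ≤ f j) : 0 < ∑ j ∈ N, f j := by
  rw [← Finset.add_sum_erase N f hk]
  -- At most `m - 1` terms lose at most `Y` each against a gain of `m Y`, so at least `Y` remains.
  have h1 := Finset.card_nsmul_le_sum (N.erase k) f (-Y) fun j hj =>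
    hf j (Finset.mem_of_mem_erase hj)
  rw [nsmul_eq_mul] at h1
  have h2 : ((N.erase k).card : ℝ) + 1 ≤ m := by
    rw [Finset.card_erase_of_mem hk]
    have := Finset.card_pos.2 ⟨k, hk⟩
    exact_mod_cast (by omega : N.card - 1 + 1 ≤ m)
  nlinarith

theorem SimpleGraph.Walk.exists_adj_of_length_eq_succ {V : Type*} {G : SimpleGraph V} {i k : V}
    {q : ℕ} (w : G.Walk i k) (h : w.length = q + 1) :
    ∃ b, G.Adj i b ∧ ∃ w' : G.Walk b k, w'.length = q := by
  cases w with
  | nil => simp at h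
  | cons hab w' => exact ⟨_, hab, w', by simpa using h⟩

theorem one_sub_epsSeq_succ (ε₀ r δ₀ : ℝ) (p : ℕ) :
    1 - epsSeq ε₀ r δ₀ (p + 1) = 1 - epsSeq ε₀ r δ₀ p + r ^ p * δ₀ := by
  rw [epsSeq]; ring

theorem monotone_one_sub_epsSeq {ε₀ r δ₀ : ℝ} (hr : 0 ≤ r) (hδ : 0 ≤ δ₀) :
    Monotone fun p => 1 - epsSeq ε₀ r δ₀ p :=
  monotone_nat_of_le_succ fun p => by
    rw [one_sub_epsSeq_succ]
    have : 0 ≤ r ^ p * δ₀ := by positivity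
    linarith

namespace Triangulation

variable {V : Type*} [Fintype V] [DecidableEq V] {Ω : Set Plane} (M : Triangulation V Ω)

theorem cell_inter_eq_empty {S T : Finset V} (hS : S ∈ M.elems) (hT : T ∈ M.elems)
    (h : Disjoint S T) : M.cell S ∩ M.cell T = ∅ := by
  rw [cell, cell, M.conforming S hS T hT, Finset.disjoint_iff_inter_eq_empty.1 h]
  simp

theorem reachable_of_mem {T : Finset V} (hT : T ∈ M.elems) {i j : V} (hi : i ∈ T) (hj : j ∈ T) :
    M.graph.Reachable i j := by
  by_cases h : i = j
  · rw [h]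
  · exact SimpleGraph.Adj.reachable (G := M.graph) ⟨h, T, hT, hi, hj⟩

/-- Otherwise the union `K` of the elements reachable from `q_i` would miss the boundary. It is
disjoint from the union `K'` of the others, so `K = Ω \ K'` is open as well as compact and nonempty,
hence the whole plane, which is not compact. -/
theorem exists_reachable_boundary (hΩ : IsOpen Ω) (i : V) :
    ∃ k, M.graph.Reachable i k ∧ M.node k ∈ frontier Ω := by
  by_contra! hno
  set K : Set Plane := ⋃ T ∈ {T ∈ (M.elems : Set (Finset V)) | ∃ v ∈ T, M.graph.Reachable i v},
    M.cell T with hK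
  set K' : Set Plane := ⋃ T ∈ {T ∈ (M.elems : Set (Finset V)) | ¬ ∃ v ∈ T, M.graph.Reachable i v},
    M.cell T with hK'
  have hKc : IsCompact K := (M.elems.finite_toSet.subset (sep_subset _ _)).isCompact_biUnion
    fun T _ => M.isCompact_cell T
  have hKc' : IsCompact K' := (M.elems.finite_toSet.subset (sep_subset _ _)).isCompact_biUnion
    fun T _ => M.isCompact_cell T
  have hmem : ∀ {T : Finset V} {w v : V}, T ∈ M.elems → (∃ v ∈ T, M.graph.Reachable i v) →
      w ∈ T → M.graph.Reachable i w := by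
    rintro T w v hT ⟨v, hv, hr⟩ hw
    exact hr.trans (M.reachable_of_mem hT hv hw)
  have hKΩ : K ⊆ Ω := by
    intro x hx
    simp only [hK, mem_iUnion₂] at hx
    obtain ⟨T, ⟨hT, hTr⟩, hxT⟩ := hx
    by_contra hxΩ
    have hxf : x ∈ frontier Ω := ⟨M.cell_subset_closure hT hxT, fun h => hxΩ (interior_subset h)⟩
    obtain ⟨B, hB, hBeq⟩ := M.frontier_eq
    have hxB := hxf
    rw [hBeq, mem_iUnion₂] at hxB
    obtain ⟨e, he, hxe⟩ := hxB
    obtain ⟨-, S, hS, h1, h2⟩ := hB e he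
    have hxS : x ∈ M.cell S :=
      (convex_convexHull ℝ _).segment_subset (M.node_mem_cell h1) (M.node_mem_cell h2) hxe
    have hnd : ¬ Disjoint S T := fun hd =>
      (M.cell_inter_eq_empty hS hT hd).subset ⟨hxS, hxT⟩
    -- An element `S` containing a boundary edge through `x` meets `T`, hence shares a vertex with
    -- it; so the endpoints of that edge would be reachable.
    obtain ⟨v, hvS, hvT⟩ := Finset.not_disjoint_iff.1 hnd
    refine hno e.1 (hmem (v := v) hS ⟨v, hvS, hmem (v := v) hT hTr hvT⟩ h1) ?_
    rw [hBeq]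
    exact mem_biUnion he (left_mem_segment ℝ _ _)
  have hKeq : K = Ω ∩ K'ᶜ := by
    ext x
    constructor
    · intro hx
      refine ⟨hKΩ hx, fun hx' => ?_⟩
      simp only [hK, mem_iUnion₂] at hx
      simp only [hK', mem_iUnion₂] at hx'
      obtain ⟨T, ⟨hT, hTr⟩, hxT⟩ := hx
      obtain ⟨S, ⟨hS, hSr⟩, hxS⟩ := hx'
      refine (M.cell_inter_eq_empty hS hT ?_).subset ⟨hxS, hxT⟩
      rw [Finset.disjoint_left]
      exact fun v hvS hvT => hSr ⟨v, hvS, hmem (v := v) hT hTr hvT⟩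
    · rintro ⟨hx, hx'⟩
      have hc := subset_closure hx
      rw [M.closure_eq, mem_iUnion₂] at hc
      obtain ⟨T, hT, hxT⟩ := hc
      by_cases hTr : ∃ v ∈ T, M.graph.Reachable i v
      · exact mem_iUnion₂.2 ⟨T, ⟨hT, hTr⟩, hxT⟩
      · exact absurd (mem_iUnion₂.2 ⟨T, ⟨hT, hTr⟩, hxT⟩) hx'
  have hopen : IsOpen K := by rw [hKeq]; exact hΩ.inter hKc'.isClosed.isOpen_compl
  have hne : K.Nonempty := by
    obtain ⟨T, hT, hi⟩ := M.exists_elem i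
    exact ⟨M.node i, mem_iUnion₂.2 ⟨T, ⟨hT, i, hi, SimpleGraph.Reachable.refl i⟩,
      M.node_mem_cell hi⟩⟩
  have huniv : K = univ := IsClopen.eq_univ ⟨hKc.isClosed, hopen⟩ hne
  exact noncompact_univ Plane (huniv ▸ hKc)

/-- The vertex just before the first boundary vertex on the walk has the required property. -/
theorem exists_nearBoundary_of_walk {i k : V} (w : M.graph.Walk i k)
    (hi : M.node i ∉ frontier Ω) (hk : M.node k ∈ frontier Ω) :
    ∃ j : M.Free, M.NearBoundary j ∧ M.graph.Reachable i j := by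
  induction w with
  | nil => exact absurd hk hi
  | @cons a b c hab w ih =>
    by_cases hb : M.node b ∈ frontier Ω
    · exact ⟨⟨a, hi⟩, ⟨b, hab, hb⟩, SimpleGraph.Reachable.refl a⟩
    · obtain ⟨j, hj, hr⟩ := ih hb hk
      exact ⟨j, hj, hab.reachable.trans hr⟩

/-- The set of lengths is nonempty, so the infimum is attained and is never the default value `sInf
∅ = 0`. -/
theorem boundaryDist_spec (hΩ : IsOpen Ω) (i : M.Free) : ∃ j : M.Free, M.NearBoundary j ∧
    ∃ w : M.graph.Walk i j, w.length = M.boundaryDist i := by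
  obtain ⟨k, ⟨w⟩, hk⟩ := M.exists_reachable_boundary hΩ i
  obtain ⟨j, hj, ⟨w'⟩⟩ := M.exists_nearBoundary_of_walk w i.2 hk
  exact Nat.sInf_mem (s := {n : ℕ | ∃ j : M.Free, M.NearBoundary j ∧
    ∃ w : M.graph.Walk i j, w.length = n}) ⟨_, j, hj, w', rfl⟩

theorem boundaryDist_le {i : V} {j : M.Free} (hj : M.NearBoundary j) (w : M.graph.Walk i j) :
    M.boundaryDist i ≤ w.length :=
  Nat.sInf_le ⟨j, hj, w, rfl⟩

theorem boundaryDist_le_succ (hΩ : IsOpen Ω) {i j : M.Free} (h : M.graph.Adj i j) :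
    M.boundaryDist j ≤ M.boundaryDist i + 1 := by
  obtain ⟨k, hk, w, hw⟩ := M.boundaryDist_spec hΩ i
  rw [← hw]
  exact M.boundaryDist_le hk (SimpleGraph.Walk.cons h.symm w)

theorem nearBoundary_of_boundaryDist_eq_zero (hΩ : IsOpen Ω) {i : M.Free}
    (h : M.boundaryDist i = 0) : M.NearBoundary i := by
  obtain ⟨k, hk, w, hw⟩ := M.boundaryDist_spec hΩ i
  rw [h] at hw
  rwa [SimpleGraph.Walk.eq_of_length_eq_zero hw]

theorem not_nearBoundary {i : M.Free} {q : ℕ} (h : M.boundaryDist i = q + 1) :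
    ¬ M.NearBoundary i := fun hn => by
  have := M.boundaryDist_le hn (SimpleGraph.Walk.nil : M.graph.Walk i i)
  rw [h] at this
  simp at this

theorem exists_adj_boundaryDist (hΩ : IsOpen Ω) {i : M.Free} {q : ℕ}
    (h : M.boundaryDist i = q + 1) :
    ∃ j : M.Free, M.graph.Adj i j ∧ M.boundaryDist j = q := by
  obtain ⟨k, hk, w, hw⟩ := M.boundaryDist_spec hΩ i
  rw [h] at hw
  obtain ⟨b, hab, w', hw'⟩ := w.exists_adj_of_length_eq_succ hw
  -- The next vertex of a shortest walk is free, since otherwise `q_i` would have distance zero.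
  have hb : M.node b ∉ frontier Ω := fun hb => M.not_nearBoundary h ⟨b, hab, hb⟩
  refine ⟨⟨b, hb⟩, hab, le_antisymm (hw' ▸ M.boundaryDist_le hk w') ?_⟩
  have := M.boundaryDist_le_succ hΩ (i := ⟨b, hb⟩) (j := i) hab.symm
  omega

theorem card_neighbors_le (i : V) [DecidableRel M.graph.Adj] :
    (Finset.univ.filter fun j => M.graph.Adj i j).card ≤ M.maxNeighbors := by
  have : (M.graph.neighborSet i).ncard = (Finset.univ.filter fun j => M.graph.Adj i j).card := by
    rw [← Set.ncard_coe_finset]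
    congr 1
    ext j
    simp
  rw [← this]
  exact Finset.le_sup (f := fun i => (M.graph.neighborSet i).ncard) (Finset.mem_univ i)

theorem elems_nonempty (M : Triangulation V Ω) (hΩ : Ω.Nonempty) : M.elems.Nonempty := by
  obtain ⟨x, hx⟩ := hΩ
  have hc := subset_closure hx
  rw [M.closure_eq, mem_iUnion₂] at hc
  obtain ⟨T, hT, -⟩ := hc
  exact ⟨T, hT⟩

theorem two_le_maxNeighbors (hΩ : Ω.Nonempty) : 2 ≤ M.maxNeighbors := by
  classical
  obtain ⟨T, hT⟩ := M.elems_nonempty hΩ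
  obtain ⟨i, j, k, hij, hik, hjk, rfl⟩ := Finset.card_eq_three.1 (M.card_elem T hT)
  refine le_trans ?_ (M.card_neighbors_le i)
  rw [← Finset.card_pair hjk]
  refine Finset.card_le_card fun v hv => ?_
  simp only [Finset.mem_insert, Finset.mem_singleton] at hv
  rw [Finset.mem_filter]
  rcases hv with rfl | rfl
  · exact ⟨Finset.mem_univ _, hij, _, hT, by simp, by simp⟩
  · exact ⟨Finset.mem_univ _, hik, _, hT, by simp, by simp⟩

end Triangulation

/-! ### From sign conditions and weighted column sums to diagonal dominance. -/

theorem strictlyDiagDominant_transpose_mul_diagonal {n : Type*} [Fintype n] [DecidableEq n]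
    {A : Matrix n n ℝ} {d : n → ℝ} (hd : ∀ i, 0 < d i) (hA : ∀ i j, j ≠ i → A j i ≤ 0)
    (hsum : ∀ i, 0 < ∑ j, A j i * d j) :
    StrictlyDiagDominant (A.transpose * Matrix.diagonal d) := by
  intro i
  simp only [Matrix.mul_diagonal, Matrix.transpose_apply]
  have h1 : ∀ j ∈ Finset.univ.erase i, |A j i * d j| = -(A j i * d j) := fun j hj =>
    abs_of_nonpos (mul_nonpos_of_nonpos_of_nonneg (hA i j (Finset.ne_of_mem_erase hj)) (hd j).le)
  rw [Finset.sum_congr rfl h1, Finset.sum_neg_distrib]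
  have h3 := Finset.add_sum_erase Finset.univ (fun j => A j i * d j) (Finset.mem_univ i)
  have h4 := hsum i
  -- The sign of the diagonal entry need not be known beforehand.
  refine lt_of_lt_of_le ?_ (le_abs_self _)
  linarith

/-- A nonempty open set has positive measure, so the almost everywhere bounds hold at some point. -/
theorem CoefficientAssumption.gη_nonneg {Ω : Set Plane} {κ g : Plane → ℝ → ℝ}
    {kα kβ Kη Gη : ℝ} (hcoef : CoefficientAssumption Ω κ g kα kβ Kη Gη) (hΩ_open : IsOpen Ω)
    (hΩ : Ω.Nonempty) : 0 ≤ Gη := by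
  have : NeBot (ae (volume.restrict Ω)) := by
    rw [ae_neBot, Ne, Measure.restrict_eq_zero]
    exact (hΩ_open.measure_pos volume hΩ).ne'
  obtain ⟨x, hx⟩ := hcoef.g_deriv.exists
  exact (hx 0).1.trans (hx 0).2

namespace Triangulation

variable {V : Type*} [Fintype V] [DecidableEq V] {Ω : Set Plane} (M : Triangulation V Ω)

section Dominance

variable {κ g : Plane → ℝ → ℝ} {kα kβ Kη Gη βm βM ε : ℝ} {u₁ u₂ : Plane → ℝ}

theorem diffConv_lt_neg (hcoef : CoefficientAssumption Ω κ g kα kβ Kη Gη)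
    (hmesh : M.AngleCondition βm βM)
    (hu₁ : u₁ ∈ M.discreteSpace) (hu₂ : u₂ ∈ M.discreteSpace)
    (hdom : M.DominanceCondition kα Kη βm βM u₂ ε) (i : M.Free) {j : V}
    (hij : M.graph.Adj i j) : M.diffConv κ u₁ u₂ j i < -(βm * ε / 2) := by
  have h1 := M.diffConv_le hcoef hmesh hu₁ hu₂ i hij
  have hβ := hmesh.βm_pos
  have h2 := hdom i j hij
  rw [div_lt_iff₀ (by positivity)] at h2
  linarith

theorem diffConv_add_massEntry_nonpos (hcoef : CoefficientAssumption Ω κ g kα kβ Kη Gη)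
    (hG : 0 ≤ Gη) (hmesh : M.AngleCondition βm βM)
    (hu₁ : u₁ ∈ M.discreteSpace) (hu₂ : u₂ ∈ M.discreteSpace)
    (hz : M.ZCondition kα Kη Gη βm βM u₂) (i : M.Free) {j : V}
    (hij : M.graph.Adj i j) : M.diffConv κ u₁ u₂ j i + M.massEntry g u₁ u₂ j i ≤ 0 := by
  have h1 := M.diffConv_le hcoef hmesh hu₁ hu₂ i hij
  have hβ := hmesh.βm_pos
  have h2 := hz i j hij
  rw [one_div, inv_mul_le_iff₀ (by positivity)] at h2
  have h3 := M.massEntry_le hcoef hG hu₁ hu₂ hij.1.symm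
  linarith

/-- The core of the argument: the one neighbor nearer to the boundary outweighs all others. The
products in `hrJ` and `hδJ` say that the guaranteed gain is `m` times the largest loss, for `p ≥ 1`
and `p = 0` respectively. -/
theorem sum_diffConv_mul_pos (hΩ_open : IsOpen Ω)
    (hcoef : CoefficientAssumption Ω κ g kα kβ Kη Gη) (hmesh : M.AngleCondition βm βM)
    (hu₁ : u₁ ∈ M.discreteSpace) (hu₂ : u₂ ∈ M.discreteSpace) (hε : 0 < ε)
    (hdom : M.DominanceCondition kα Kη βm βM u₂ ε) {JL JU : ℝ}
    (hJ : M.CouplingBounds κ u₁ u₂ βm ε JL JU) {ε₀ r δ₀ : ℝ} (h1 : ε₀ < 1) (hr : 0 < r)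
    (hδ : 0 < δ₀) (hrJ : M.maxNeighbors * JU * r = JL)
    (hδJ : M.maxNeighbors * JU * δ₀ = ε * βm * (1 - ε₀) / 2) (i : M.Free) :
    0 < ∑ j : M.Free,
      M.diffConv κ u₁ u₂ j i * (1 - epsSeq ε₀ r δ₀ (M.boundaryDist j)) := by
  classical
  obtain ⟨hJ1, hJ2, hJ3⟩ := hJ
  have hβ := hmesh.βm_pos
  have hJL : 0 < JL := lt_of_lt_of_le (by positivity) hJ1
  have hJU : 0 < JU := hJL.trans_le hJ2
  set d : ℕ → ℝ := fun p => 1 - epsSeq ε₀ r δ₀ p with hd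
  have hmono : Monotone d := monotone_one_sub_epsSeq hr.le hδ.le
  have hd0 : d 0 = 1 - ε₀ := rfl
  have hdpos : ∀ p, 0 < d p := fun p => by
    have := hmono (Nat.zero_le p); rw [hd0] at this; linarith
  have hdsucc : ∀ p, d (p + 1) = d p + r ^ p * δ₀ := one_sub_epsSeq_succ ε₀ r δ₀
  -- Zero on the boundary: the sum can then run over all vertices, where `sum_diffConv` applies, and
  -- a boundary neighbor contributes the full weight `D i`.
  set D : V → ℝ := fun v => if M.node v ∈ frontier Ω then 0 else d (M.boundaryDist v) with hD
  have hDf : ∀ j : M.Free, D j = d (M.boundaryDist j) := fun j => if_neg j.2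
  have hDb : ∀ v, M.node v ∈ frontier Ω → D v = 0 := fun v hv => if_pos hv
  set N : Finset V := Finset.univ.filter fun j => M.graph.Adj i j with hN
  have hNi : ∀ {j}, j ∈ N ↔ M.graph.Adj i j := by intro j; simp [hN]
  have e1 : ∑ j : M.Free, M.diffConv κ u₁ u₂ j i * d (M.boundaryDist j) =
      ∑ v, M.diffConv κ u₁ u₂ v i * D v := by
    have hs := Finset.sum_subtype_of_mem (s := Finset.univ.filter fun v => M.node v ∉ frontier Ω)
      (fun v => M.diffConv κ u₁ u₂ v i * D v) (p := fun v => M.node v ∉ frontier Ω) (by simp)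
    have hs' : ∑ v ∈ Finset.univ.filter (fun v => M.node v ∉ frontier Ω),
        M.diffConv κ u₁ u₂ v i * D v = ∑ v, M.diffConv κ u₁ u₂ v i * D v := by
      refine Finset.sum_subset (Finset.subset_univ _) fun v _ hv => ?_
      rw [hDb v (by simpa using hv), mul_zero]
    rw [← hs', ← hs]
    refine Finset.sum_congr ?_ fun j _ => by rw [hDf]
    ext j
    simp [j.2]
  have e2 : ∑ v, M.diffConv κ u₁ u₂ v i * D v =
      ∑ j ∈ N, (-M.diffConv κ u₁ u₂ j i) * (D i - D j) := by
    -- Subtracting this zero replaces weights by their differences and removes the diagonal term.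
    have h0 : ∑ v, M.diffConv κ u₁ u₂ v i * D i = 0 := by
      rw [← Finset.sum_mul, M.sum_diffConv hcoef hu₁ hu₂, zero_mul]
    rw [← sub_zero (∑ v, M.diffConv κ u₁ u₂ v i * D v), ← h0, ← Finset.sum_sub_distrib]
    symm
    refine (Finset.sum_congr rfl fun v _ => by ring).trans
      (Finset.sum_subset (Finset.subset_univ N) fun v _ hv => ?_)
    by_cases hvi : v = i
    · rw [hvi, sub_self]
    · rw [hNi] at hv
      rw [M.diffConv_eq_zero, zero_mul, zero_mul, sub_self]
      rintro ⟨T, hT, hv', hi⟩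
      exact hv ⟨fun h => hvi h.symm, T, hT, hi, hv'⟩
  rw [e1, e2]
  have hneg : ∀ j ∈ N, βm * ε / 2 < -M.diffConv κ u₁ u₂ j i := fun j hj => by
    have := M.diffConv_lt_neg hcoef hmesh hu₁ hu₂ hdom i (hNi.1 hj)
    linarith
  have hnegf : ∀ j : M.Free, (j : V) ∈ N →
      JL ≤ -M.diffConv κ u₁ u₂ j i ∧ -M.diffConv κ u₁ u₂ j i ≤ JU := fun j hj => by
    have hb := hJ3 i j (hNi.1 hj)
    have hp : 0 < βm * ε / 2 := by positivity
    rwa [abs_of_neg (by linarith [hneg j hj])] at hb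
  set p := M.boundaryDist i with hp
  set Y := JU * (r ^ p * δ₀) with hY
  have hY0 : 0 < Y := by positivity
  -- The distance of a free neighbor is at most `p + 1`, so its weight exceeds `d p` by at most `r^p
  -- δ₀`; a boundary neighbor causes no loss.
  have hlow : ∀ j ∈ N, -Y ≤ (-M.diffConv κ u₁ u₂ j i) * (D i - D j) := by
    intro j hj
    have hpos : 0 < -M.diffConv κ u₁ u₂ j i := lt_trans (by positivity) (hneg j hj)
    by_cases hjb : M.node j ∈ frontier Ω
    · rw [hDb j hjb, hDf, sub_zero]
      have := mul_pos hpos (hdpos p)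
      linarith
    · have hle := hmono (M.boundaryDist_le_succ hΩ_open (i := i) (j := ⟨j, hjb⟩) (hNi.1 hj))
      rw [hdsucc] at hle
      have hDj := hDf ⟨j, hjb⟩
      have hJj := (hnegf ⟨j, hjb⟩ hj).2
      simp only at hDj hle hJj
      rw [hDf, hDj]
      calc -Y = -(JU * (r ^ p * δ₀)) := rfl
        _ ≤ -((-M.diffConv κ u₁ u₂ j i) * (r ^ p * δ₀)) := by gcongr
        _ = (-M.diffConv κ u₁ u₂ j i) * (-(r ^ p * δ₀)) := by ring
        _ ≤ _ := by
          apply mul_le_mul_of_nonneg_left _ hpos.le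
          linarith
  have hcard : N.card ≤ M.maxNeighbors := M.card_neighbors_le i
  rcases hpq : p with _ | q
  · obtain ⟨k, hik, hk⟩ := M.nearBoundary_of_boundaryDist_eq_zero hΩ_open hpq
    refine Finset.sum_pos_of_dominant_term (hNi.2 hik) hcard hY0 ?_ hlow
    -- The bounds `JL`, `JU` concern only edges between free vertices; at the boundary neighbor the
    -- bound `βm ε / 2` takes over, which explains the form of `δ₀`.
    rw [hDb k hk, hDf, sub_zero, ← hp, hpq, hd0, hY, hpq, pow_zero, one_mul, ← mul_assoc, hδJ]
    have := mul_le_mul_of_nonneg_right (hneg k (hNi.2 hik)).le (sub_nonneg.2 h1.le)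
    linarith
  · obtain ⟨k, hik, hk⟩ := M.exists_adj_boundaryDist hΩ_open hpq
    refine Finset.sum_pos_of_dominant_term (hNi.2 hik) hcard hY0 ?_ hlow
    rw [hDf, hDf, hk, ← hp, hpq, hdsucc, add_sub_cancel_left, hY, hpq]
    -- One factor `r` turns `m JU` into `JL`: the loss scales with `r^(q+1)`, the gain with `r^q`.
    calc (M.maxNeighbors : ℝ) * (JU * (r ^ (q + 1) * δ₀)) =
        M.maxNeighbors * JU * r * (r ^ q * δ₀) := by ring
      _ = JL * (r ^ q * δ₀) := by rw [hrJ]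
      _ ≤ _ := by
        have := (hnegf k (hNi.2 hik)).1
        gcongr

theorem assembled_apply (i j : M.Free) :
    M.assembled κ g u₁ u₂ i j = M.diffConv κ u₁ u₂ i j + M.massEntry g u₁ u₂ i j := rfl

theorem strictlyDiagDominant_assembled
    (hcoef : CoefficientAssumption Ω κ g kα kβ Kη Gη) (hG : 0 ≤ Gη)
    (hmesh : M.AngleCondition βm βM)
    (hu₁ : u₁ ∈ M.discreteSpace) (hu₂ : u₂ ∈ M.discreteSpace)
    (hz : M.ZCondition kα Kη Gη βm βM u₂) {d : M.Free → ℝ} (hd : ∀ i, 0 < d i)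
    (hsum : ∀ i : M.Free, 0 < ∑ j : M.Free, M.diffConv κ u₁ u₂ j i * d j) :
    StrictlyDiagDominant ((M.assembled κ g u₁ u₂).transpose * Matrix.diagonal d) := by
  refine strictlyDiagDominant_transpose_mul_diagonal hd (fun i j hji => ?_) fun i => ?_
  · rw [assembled_apply]
    by_cases hij : M.graph.Adj i j
    · exact M.diffConv_add_massEntry_nonpos hcoef hG hmesh hu₁ hu₂ hz i hij
    · have hne : ¬ ∃ T ∈ M.elems, (j : V) ∈ T ∧ (i : V) ∈ T := by
        rintro ⟨T, hT, hj', hi⟩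
        exact hij ⟨fun h => hji (Subtype.ext h.symm), T, hT, hi, hj'⟩
      rw [M.diffConv_eq_zero hne, M.massEntry_eq_zero hne, add_zero]
  -- The reaction part is nonnegative entrywise, so it only increases the weighted sum.
  · refine (hsum i).trans_le (Finset.sum_le_sum fun j _ =>
      mul_le_mul_of_nonneg_right ?_ (hd j).le)
    rw [assembled_apply]
    linarith [M.massEntry_nonneg hcoef hu₁ hu₂ (j : V) i]

theorem exists_couplingBounds (κ : Plane → ℝ → ℝ) (u₁ u₂ : Plane → ℝ)
    (h : ∀ i j : M.Free, M.graph.Adj i j → βm * ε / 2 ≤ |M.diffConv κ u₁ u₂ j i|) :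
    ∃ JL JU : ℝ, M.CouplingBounds κ u₁ u₂ βm ε JL JU := by
  obtain ⟨B, hB⟩ := (Set.finite_range fun p : M.Free × M.Free =>
    |M.diffConv κ u₁ u₂ p.2 p.1|).bddAbove
  -- The maximum keeps `JL ≤ JU` even if no edge joins two free vertices.
  exact ⟨βm * ε / 2, max (βm * ε / 2) B, le_rfl, le_max_left _ _, fun i j hij =>
    ⟨h i j hij, (hB ⟨(i, j), rfl⟩).trans (le_max_right _ _)⟩⟩

theorem eventually_dominanceCondition_iff :
    (∀ᶠ ε in 𝓝[>] (0 : ℝ), M.DominanceCondition kα Kη βm βM u₂ ε) ↔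
      M.StrictZCondition kα Kη 0 βm βM u₂ := by
  have e : ∀ i j, 1 / (3 * βm) * (Kη * βM * M.patchDiff u₂ i j + 0 * M.maxArea) =
      Kη * βM * M.patchDiff u₂ i j / (3 * βm) := by intro i j; ring
  constructor
  · intro h
    obtain ⟨ε, h1, h2⟩ := (h.and self_mem_nhdsWithin).exists
    intro i j hij
    have h3 := h1 i j hij
    have h4 : (0 : ℝ) < ε := h2
    rw [e]
    linarith
  · intro h
    -- There are finitely many edges, so a margin for each edge gives a common one.
    simp only [DominanceCondition, eventually_all]
    intro i j hij
    have h1 := h i j hij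
    rw [e] at h1
    filter_upwards [nhdsWithin_le_nhds (eventually_lt_nhds (sub_pos.2 h1))] with ε hε
    linarith

end Dominance

end Triangulation

/-! ### The theorem. -/

theorem mainTheorem2 {V : Type*} [Fintype V] [DecidableEq V]
    (Ω : Set Plane) (hΩ_open : IsOpen Ω) (hΩ_nonempty : Ω.Nonempty)
    (M : Triangulation V Ω)
    (κ g : Plane → ℝ → ℝ) (kα kβ Kη Gη βm βM : ℝ)
    (hcoef : CoefficientAssumption Ω κ g kα kβ Kη Gη)
    (hmesh : M.AngleCondition βm βM)
    (u₁ u₂ : Plane → ℝ) (hu₁ : u₁ ∈ M.discreteSpace) (hu₂ : u₂ ∈ M.discreteSpace) :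
    (∀ ε : ℝ, 0 < ε →
      M.ZCondition kα Kη Gη βm βM u₂ → M.DiagCondition kα Kη u₂ →
      M.DominanceCondition kα Kη βm βM u₂ ε →
        (∃ JL JU : ℝ, M.CouplingBounds κ u₁ u₂ βm ε JL JU) ∧
        ∀ JL JU : ℝ, M.CouplingBounds κ u₁ u₂ βm ε JL JU →
        ∀ ε₀ : ℝ, 0 < ε₀ → ε₀ < 1 →
        ∀ r δ₀ : ℝ, r = JL / (M.maxNeighbors * JU) →
          δ₀ = ε * βm * (1 - ε₀) / (2 * M.maxNeighbors * JU) →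
          (0 < r ∧ r < 1) ∧ (0 < δ₀ ∧ δ₀ < 1) ∧
          (∀ i : M.Free, 0 < 1 - epsSeq ε₀ r δ₀ (M.boundaryDist i)) ∧
          StrictlyDiagDominant ((M.assembled κ g u₁ u₂).transpose *
            Matrix.diagonal fun i : M.Free => 1 - epsSeq ε₀ r δ₀ (M.boundaryDist i))) ∧
    ((∀ᶠ ε in 𝓝[>] (0 : ℝ), M.DominanceCondition kα Kη βm βM u₂ ε) ↔
      M.StrictZCondition kα Kη 0 βm βM u₂) ∧
    (M.StrictZCondition kα Kη Gη βm βM u₂ →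
      ∀ᶠ ε in 𝓝[>] (0 : ℝ), M.DominanceCondition kα Kη βm βM u₂ ε) ∧
    (0 < Gη → M.ZCondition kα Kη Gη βm βM u₂ →
      ∀ᶠ ε in 𝓝[>] (0 : ℝ), M.DominanceCondition kα Kη βm βM u₂ ε) := by
  have hG : 0 ≤ Gη := hcoef.gη_nonneg hΩ_open hΩ_nonempty
  have hβ := hmesh.βm_pos
  refine ⟨?_, M.eventually_dominanceCondition_iff, fun h => ?_, fun hG' h => ?_⟩
  · intro ε hε hz _ hdom
    refine ⟨M.exists_couplingBounds κ u₁ u₂ fun i j hij => ?_, ?_⟩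
    · have := M.diffConv_lt_neg hcoef hmesh hu₁ hu₂ hdom i hij
      exact le_trans (by linarith) (neg_le_abs _)
    intro JL JU hJ ε₀ h0 h1 r δ₀ hr hδ
    have hm := M.two_le_maxNeighbors hΩ_nonempty
    have hm' : (2 : ℝ) ≤ M.maxNeighbors := by exact_mod_cast hm
    have hJL : 0 < JL := lt_of_lt_of_le (by positivity) hJ.1
    have hJU : 0 < JU := hJL.trans_le hJ.2.1
    have hmJ : 0 < M.maxNeighbors * JU := by positivity
    have h1' : 0 < 1 - ε₀ := sub_pos.2 h1
    -- Two neighbors at some vertex make this strict even when `JL = JU`.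
    have hJm : JL < M.maxNeighbors * JU := by
      have := mul_le_mul_of_nonneg_right hm' hJU.le
      linarith [hJ.2.1]
    have hr0 : 0 < r := by rw [hr]; positivity
    have hδ0 : 0 < δ₀ := by rw [hδ]; positivity
    have hrJ : M.maxNeighbors * JU * r = JL := by rw [hr]; field_simp
    have hδJ : M.maxNeighbors * JU * δ₀ = ε * βm * (1 - ε₀) / 2 := by rw [hδ]; field_simp
    have hd : ∀ p, 0 < 1 - epsSeq ε₀ r δ₀ p := fun p =>
      h1'.trans_le (monotone_one_sub_epsSeq hr0.le hδ0.le (Nat.zero_le p))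
    refine ⟨⟨hr0, ?_⟩, ⟨hδ0, ?_⟩, fun i => hd _, ?_⟩
    · rw [hr, div_lt_one hmJ]
      exact hJm
    · have h2 : ε * βm * (1 - ε₀) ≤ ε * βm * 1 := by gcongr; linarith
      -- The left side is at most `βm ε / 2 ≤ JL < m JU`.
      have h3 : M.maxNeighbors * JU * δ₀ < M.maxNeighbors * JU * 1 := by linarith [hJ.1]
      exact lt_of_mul_lt_mul_left h3 hmJ.le
    · exact M.strictlyDiagDominant_assembled hcoef hG hmesh hu₁ hu₂ hz (fun i => hd _)
        (M.sum_diffConv_mul_pos hΩ_open hcoef hmesh hu₁ hu₂ hε hdom hJ h1 hr0 hδ0 hrJ hδJ)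
  · refine M.eventually_dominanceCondition_iff.2 fun i j hij => lt_of_le_of_lt ?_ (h i j hij)
    have := M.maxArea_nonneg
    gcongr
  -- Dropping the positive term `Gη * M.maxArea` makes the inequality strict.
  · refine M.eventually_dominanceCondition_iff.2 fun i j hij => lt_of_lt_of_le ?_ (h i j hij)
    obtain ⟨T, hT⟩ := M.elems_nonempty hΩ_nonempty
    have := (M.area_pos hT).trans_le (M.area_le_maxArea hT)
    gcongr

end
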